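/- **Setting.** Let $d\in\{2,3\}$ and let $\Omega\subset\mathbb R^d$ be a bounded Lipschitz domain with outer unit normal $n$; let $\Gamma_D\subset\partial\Omega$ be measurable. Let $1<p<2$ and $\nu_\infty,\nu,\delta>0$. For symmetric $d\times d$ matrices put $A:B=\sum_{i,j}A_{ij}B_{ij}$, $|A|^2=A:A$, $\mu(A)=\nu(\delta^2+|A|^2)^{(p-2)/2}$, $\eta(A)=\nu_\infty+\mu(A)$, $S(A)=\eta(A)A$, with derivative $$DS(A)[B]=\eta(A)B+\nu(p-2)(\delta^2+|A|^2)^{\frac{p-4}{2}}(A:B)A .$$ Let $\mathcal M_h$ be a shape-regular mesh of $\Omega$: finitely many closed cells with pairwise disjoint interiors cover $\overline\Omega$, each cell $K$ is the image of the unit simplex or unit cube under an injective polynomial map $F_K$ of degree at most $m$ with $|DF_K|\le\kappa h_K$, $|DF_K^{-1}|\le\kappa/h_K$, $h_K=\operatorname{diam}K$. Let $V_h\subset H^1(\Omega)^d$ be any linear space of continuous fields $v_h$ such that every $v_h\circ F_K$ is polynomial of degree at most $k$. Let $h_\Gamma>0$ be a measurable local mesh size on $\Gamma_D$, i.e. $\kappa^{-1}h_K\le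 h_\Gamma\le\kappa h_K$ on $\Gamma_D\cap K$ for every cell $K$, almost everywhere. Write $Dv=\frac12(\nabla v+\nabla v^{\top})$. Let $\hat g_D\in H^1(\Omega)^d$ (the lifting of the Dirichlet data) and let $T=T(x)$, $x\in\Omega$, be a measurable field of linear maps from symmetric to symmetric matrices (the constitutive tangent at a Newton state). Assume that $T$ and $D\hat g_D$ have traces on $\Gamma_D$, denoted by the same symbols (at almost every $x\in\Gamma_D$ they are the $L^1$-limits of the values on $B(x,r)\cap\Omega$ as $r\to0$). For $\gamma_1,\gamma_2>0$ define $$\begin{aligned}a_\star(v,w)={}&(T(Dv),Dw)_{\Omega}-(T(Dv)n,w)_{\Gamma_D}-(v,DS(D\hat g_D)[Dw]\,n)_{\Gamma_D}\\&+\gamma_1(h_\Gamma^{-1}\eta(D\hat g_D)v,w)_{\Gamma_D}+\gamma_2(h_\Gamma^{-1}v\cdot n,w\cdot n)_{\Gamma_D}.\end{aligned}$$ Assume that for some $\overline\eta\ge\nu_\infty$, for a.e. $x\in\Omega$ and all symmetric $B$, $$\nu_\infty|B|^2\le T(B):B,\qquad |T(B)|+|DS(D\hat g_D)[B]|\le\overline\eta\,|B|.\tag{1}$$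 **Claim.** (a) There is a constant $c>0$, depending only on $d,k,m,\kappa$ and $\overline\eta/\nu_\infty$, such that with $C_{\rm tr}=\nu_\infty c$ one has for all $v_h\in V_h$ $$a_\star(v_h,v_h)\ge\tfrac{\nu_\infty}{2}\|Dv_h\|_{L^2(\Omega)}^2+(\gamma_1\nu_\infty-C_{\rm tr})\|h_\Gamma^{-1/2}v_h\|_{L^2(\Gamma_D)}^2+\gamma_2\|h_\Gamma^{-1/2}v_h\cdot n\|_{L^2(\Gamma_D)}^2 .$$ (b) If $\gamma_1\ge 2C_{\rm tr}/\nu_\infty$, then $a_\star$ is coercive on $V_h$: for all $v_h\in V_h$, $$a_\star(v_h,v_h)\ge\tfrac{\nu_\infty}{2}\|Dv_h\|_{L^2(\Omega)}^2+\tfrac{\gamma_1\nu_\infty}{2}\|h_\Gamma^{-1/2}v_h\|_{L^2(\Gamma_D)}^2+\gamma_2\|h_\Gamma^{-1/2}v_h\cdot n\|_{L^2(\Gamma_D)}^2 ,$$ and, if $\Gamma_D$ has positive surface measure, there is $\alpha>0$ (which may depend on $V_h$ and on all data) with $a_\star(v_h,v_h)\ge\alpha\|v_h\|_{H^1(\Omega)}^2$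 for all $v_h\in V_h$. (c) The following tangents at a symmetric matrix $A$ (the value of $Dv^m$ for the Newton state) satisfy (1) with a constant $\overline\eta\geq\nu_\infty$ depending only on $\nu_\infty,\nu,\delta,p$, for all symmetric $A$ and all symmetric values of $D\hat g_D$: the Picard tangent $B\mapsto\eta(A)B$; the exact Newton tangent $B\mapsto DS(A)[B]$; and, for every $\sigma_{\max}\ge0$, the modified Newton tangent $B\mapsto\eta(A)B+s\theta(\sigma:B)\sigma$, where $\sigma=\mu(A)A$, $\theta=(p-2)/(\mu(A)(\delta^2+|A|^2))$, $s=\min\{1,\sigma_{\max}/|\sigma|\}$ if $\sigma\ne0$ and $s=0$ if $\sigma=0$. -/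

import Mathlib

open MeasureTheory Set Filter Topology
open scoped ContDiff

namespace NitscheNS

noncomputable section

/-- Euclidean `d`-space. -/
abbrev E (d : ℕ) := EuclideanSpace ℝ (Fin d)

/-! ### Symmetric matrices -/

/-- The space of symmetric real `d × d` matrices. -/
def SymMat (d : ℕ) : Submodule ℝ (Matrix (Fin d) (Fin d) ℝ) where
  carrier := {A | A.transpose = A}
  add_mem' := by
    intro A B hA hB
    simp only [Set.mem_ofPred_eq] at *
    rw [Matrix.transpose_add, hA, hB]
  zero_mem' := by simp
  smul_mem' := by
    intro c A hA
    simp only [Set.mem_ofPred_eq] at *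
    rw [Matrix.transpose_smul, hA]

/-- The symmetric part `(J + Jᵀ) / 2` of a matrix. -/
def symPart {d : ℕ} (J : Matrix (Fin d) (Fin d) ℝ) : SymMat d :=
  ⟨(1 / 2 : ℝ) • (J + J.transpose), by
    change ((1 / 2 : ℝ) • (J + J.transpose)).transpose = _
    rw [Matrix.transpose_smul, Matrix.transpose_add, Matrix.transpose_transpose, add_comm]⟩

/-- The Frobenius product `A : B`. -/
def frob {d : ℕ} (A B : SymMat d) : ℝ := ∑ i, ∑ j, A.1 i j * B.1 i j

/-- The Frobenius norm `|A|`. -/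
def frobNorm {d : ℕ} (A : SymMat d) : ℝ := Real.sqrt (frob A A)

/-- `A n · w` for a symmetric matrix `A` and vectors `n`, `w`. -/
def normalPairing {d : ℕ} (A : SymMat d) (n w : E d) : ℝ := ∑ i, (∑ j, A.1 i j * n j) * w i

/-- `B ↦ (A : B) A` as a linear map. -/
def rankOne {d : ℕ} (A : SymMat d) : SymMat d →ₗ[ℝ] SymMat d where
  toFun B := frob A B • A
  map_add' B C := by
    rw [← add_smul]
    congr 1
    simp [frob, mul_add, Finset.sum_add_distrib]
  map_smul' c B := by
    rw [RingHom.id_apply, smul_smul]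
    congr 1
    simp only [frob, Finset.mul_sum]
    refine Finset.sum_congr rfl fun i _ => Finset.sum_congr rfl fun j _ => ?_
    simp only [Submodule.coe_smul, Matrix.smul_apply, smul_eq_mul]
    ring

/-! ### The regularized `(p, δ)` stress law and its tangents -/

/-- Parameters of the shear-thinning, uniformly elliptic `(p, δ)` stress law. -/
structure Rheology where
  /-- the limiting viscosity `ν_∞` -/
  νInf : ℝ
  /-- the viscosity `ν` -/
  ν : ℝ
  /-- the regularization `δ` -/
  δ : ℝ
  /-- the exponent `p` -/
  p : ℝ
  νInf_pos : 0 < νInf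
  ν_pos : 0 < ν
  δ_pos : 0 < δ
  one_lt_p : 1 < p
  p_lt_two : p < 2

namespace Rheology

variable (R : Rheology) {d : ℕ}

/-- `μ(A) = ν (δ² + |A|²)^((p-2)/2)`. -/
def shearVisc (A : SymMat d) : ℝ := R.ν * (R.δ ^ 2 + frob A A) ^ ((R.p - 2) / 2)

/-- The effective viscosity `η(A) = ν_∞ + ν (δ² + |A|²)^((p-2)/2)`. -/
def effVisc (A : SymMat d) : ℝ := R.νInf + R.shearVisc A

/-- The stress `S(A) = η(A) A`. -/
def stress (A : SymMat d) : SymMat d := R.effVisc A • A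

/-- The derivative of the stress,
`DS(A)[B] = η(A) B + ν (p-2) (δ² + |A|²)^((p-4)/2) (A : B) A`
(see `hasDerivAt_stress`). As a tangent at `A` this is the exact Newton tangent. -/
def dStress (A : SymMat d) : SymMat d →ₗ[ℝ] SymMat d :=
  R.effVisc A • LinearMap.id
    + (R.ν * (R.p - 2) * (R.δ ^ 2 + frob A A) ^ ((R.p - 4) / 2)) • rankOne A

/-- The Picard tangent `B ↦ η(A) B`. -/
def picardTangent (A : SymMat d) : SymMat d →ₗ[ℝ] SymMat d := R.effVisc A • LinearMap.id

open Classical in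
/-- The clipping factor `s`: `min {1, σmax / |σ|}` for `σ = μ(A) A ≠ 0`, and `0` for `σ = 0`. -/
def clip (σmax : ℝ) (A : SymMat d) : ℝ :=
  if R.shearVisc A • A = 0 then 0 else min 1 (σmax / frobNorm (R.shearVisc A • A))

/-- The modified Newton tangent `B ↦ η(A) B + s θ (σ : B) σ` with `σ = μ(A) A` and
`θ = (p-2) / (μ(A) (δ² + |A|²))`. -/
def modTangent (σmax : ℝ) (A : SymMat d) : SymMat d →ₗ[ℝ] SymMat d :=
  R.effVisc A • LinearMap.id
    + (R.clip σmax A * ((R.p - 2) / (R.shearVisc A * (R.δ ^ 2 + frob A A))))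
        • rankOne (R.shearVisc A • A)

/-- The pointwise tangent bounds
`ν_∞ |B|² ≤ T(B) : B` and `|T(B)| + |DS(G)[B]| ≤ ηbar |B|` for all symmetric `B`. -/
def TangentBounds (ηbar : ℝ) (T : SymMat d →ₗ[ℝ] SymMat d) (G : SymMat d) : Prop :=
  ∀ B : SymMat d, R.νInf * frobNorm B ^ 2 ≤ frob (T B) B ∧
    frobNorm (T B) + frobNorm (R.dStress G B) ≤ ηbar * frobNorm B

theorem frob_add_smul (A B : SymMat d) (t : ℝ) :
    frob (A + t • B) (A + t • B) = frob A A + 2 * t * frob A B + t ^ 2 * frob B B := by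
  simp only [frob, Finset.mul_sum, ← Finset.sum_add_distrib]
  refine Finset.sum_congr rfl fun i _ => Finset.sum_congr rfl fun j _ => ?_
  simp only [Submodule.coe_add, Submodule.coe_smul, Matrix.add_apply, Matrix.smul_apply,
    smul_eq_mul]
  ring

theorem frob_self_nonneg (A : SymMat d) : 0 ≤ frob A A :=
  Finset.sum_nonneg fun _ _ => Finset.sum_nonneg fun _ _ => mul_self_nonneg _

/-- `dStress` is the (directional) derivative of `stress`. -/
theorem hasDerivAt_stress (A B : SymMat d) (i j : Fin d) :
    HasDerivAt (fun t : ℝ => (R.stress (A + t • B)).1 i j) ((R.dStress A B).1 i j) 0 := by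
  have hδ := R.δ_pos
  have hq : HasDerivAt (fun t : ℝ => R.δ ^ 2 + frob (A + t • B) (A + t • B))
      (2 * frob A B) 0 := by
    have h1 : HasDerivAt (fun t : ℝ => R.δ ^ 2 + (frob A A + 2 * t * frob A B
        + t ^ 2 * frob B B)) (2 * 1 * frob A B + (2 * (0 : ℝ)) * frob B B) 0 := by
      refine HasDerivAt.const_add _ (HasDerivAt.add (HasDerivAt.const_add _ ?_) ?_)
      · exact ((hasDerivAt_id (0 : ℝ)).const_mul 2).mul_const _
      · simpa using (hasDerivAt_pow 2 (0 : ℝ)).mul_const (frob B B)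
    have he : (fun t : ℝ => R.δ ^ 2 + frob (A + t • B) (A + t • B)) =
        fun t : ℝ => R.δ ^ 2 + (frob A A + 2 * t * frob A B + t ^ 2 * frob B B) := by
      funext t
      rw [frob_add_smul]
    rw [he]
    convert h1 using 1
    ring
  have hpos : R.δ ^ 2 + frob A A ≠ 0 := by
    have := frob_self_nonneg A
    positivity
  have hp := (hq.rpow_const (p := (R.p - 2) / 2) (Or.inl (by simpa using hpos))).const_mul R.ν
  have hp' := hp.const_add R.νInf
  have hl : HasDerivAt (fun t : ℝ => A.1 i j + t * B.1 i j) (B.1 i j) 0 := by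
    simpa using ((hasDerivAt_id (0 : ℝ)).mul_const (B.1 i j)).const_add (A.1 i j)
  have := hp'.mul hl
  refine (this.congr_deriv ?_)
  have he : (R.p - 2) / 2 - 1 = (R.p - 4) / 2 := by ring
  simp only [dStress, effVisc, shearVisc, rankOne, LinearMap.add_apply, LinearMap.smul_apply,
    LinearMap.id_apply, LinearMap.coe_mk, AddHom.coe_mk, Submodule.coe_add, Submodule.coe_smul,
    Matrix.add_apply, Matrix.smul_apply, smul_eq_mul, zero_smul, add_zero, zero_mul, he]
  ring

end Rheology

/-! ### Lipschitz domains, surface measure, outer normal, boundary traces -/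

/-- Bounded Lipschitz domain: nonempty, open, connected, bounded, and near each boundary point it
is the set above the graph, in some direction `e`, of a Lipschitz function `φ` of the coordinates
orthogonal to `e`. -/
structure IsLipschitzDomain {d : ℕ} (Ω : Set (E d)) : Prop where
  isOpen : IsOpen Ω
  isConnected : IsConnected Ω
  isBounded : Bornology.IsBounded Ω
  local_graph : ∀ x ∈ frontier Ω, ∃ r : ℝ, 0 < r ∧ ∃ e : E d, ‖e‖ = 1 ∧
    ∃ L : NNReal, ∃ φ : E d → ℝ, LipschitzWith L φ ∧ (∀ y (t : ℝ), φ (y + t • e) = φ y) ∧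
      ∀ y ∈ Metric.ball x r, y ∈ Ω ↔ φ y < inner ℝ y e

/-- Surface measure: the `(d-1)`-dimensional Hausdorff measure, normalized so as to agree with
Lebesgue measure on hyperplanes. -/
def surf (d : ℕ) : Measure (E d) := Measure.euclideanHausdorffMeasure (d - 1)

/-- `n` is the outer unit normal of `Ω` at `x`: up to cones of arbitrarily small opening about the
hyperplane `x + n^⊥`, the set `Ω` is near `x` the half-space of the `y` with `(y - x) · n < 0`. -/
def IsOuterNormalAt {d : ℕ} (Ω : Set (E d)) (x n : E d) : Prop :=
  ‖n‖ = 1 ∧ ∀ ε : ℝ, 0 < ε → ∃ r : ℝ, 0 < r ∧ ∀ y ∈ Metric.ball x r,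
    (inner ℝ (y - x) n < -ε * ‖y - x‖ → y ∈ Ω) ∧
    (ε * ‖y - x‖ < inner ℝ (y - x) n → y ∉ closure Ω)

theorem IsOuterNormalAt.unique {d : ℕ} {Ω : Set (E d)} {x n n' : E d}
    (h : IsOuterNormalAt Ω x n) (h' : IsOuterNormalAt Ω x n') : n = n' := by
  by_contra hne
  set u := n' - n with hu
  have hu0 : 0 < ‖u‖ := norm_pos_iff.2 (sub_ne_zero.2 (Ne.symm hne))
  have hsq : ‖u‖ ^ 2 = 2 - 2 * inner ℝ n' n := by
    rw [hu, norm_sub_sq_real, h.1, h'.1]; ring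
  have h1 : inner ℝ u n = -(‖u‖ ^ 2 / 2) := by
    rw [hsq, hu, inner_sub_left, real_inner_self_eq_norm_sq, h.1]; ring
  have h2 : inner ℝ u n' = ‖u‖ ^ 2 / 2 := by
    rw [hsq, hu, inner_sub_left, real_inner_self_eq_norm_sq, h'.1, real_inner_comm]; ring
  obtain ⟨r, hr, hb⟩ := h.2 (‖u‖ / 4) (by positivity)
  obtain ⟨r', hr', hb'⟩ := h'.2 (‖u‖ / 4) (by positivity)
  have hm : 0 < min r r' := lt_min hr hr'
  set t := min r r' / (2 * ‖u‖) with ht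
  have ht0 : 0 < t := by positivity
  have htu : t * ‖u‖ < min r r' := by
    have : t * ‖u‖ = min r r' / 2 := by rw [ht]; field_simp
    rw [this]; linarith
  have hsub : (x + t • u) - x = t • u := by abel
  have hn : ‖t • u‖ = t * ‖u‖ := by rw [norm_smul, Real.norm_of_nonneg ht0.le]
  have hball : dist (x + t • u) x = t * ‖u‖ := by rw [dist_eq_norm, hsub, hn]
  have hy := (hb (x + t • u) (by
    rw [Metric.mem_ball, hball]; exact htu.trans_le (min_le_left _ _))).1
  have hy' := (hb' (x + t • u) (by
    rw [Metric.mem_ball, hball]; exact htu.trans_le (min_le_right _ _))).2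
  rw [hsub, hn, real_inner_smul_left] at hy hy'
  have hpos : 0 < t * ‖u‖ ^ 2 := by positivity
  exact hy' (by rw [h2]; nlinarith) (subset_closure (hy (by rw [h1]; nlinarith)))

open Classical in
/-- The outer unit normal of `Ω` (where it exists, hence almost everywhere on the boundary of a
Lipschitz domain; it is unique there by `IsOuterNormalAt.unique`). -/
def outerNormal {d : ℕ} (Ω : Set (E d)) (x : E d) : E d :=
  if h : ∃ n, IsOuterNormalAt Ω x n then h.choose else 0

/-- The value of `F` at the boundary point `x` is the trace of `F|_Ω` there:
the averages of `|F(y) - F(x)|` over `B(x, r) ∩ Ω` tend to `0` as `r → 0`. -/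
def HasTraceAt {d : ℕ} (Ω : Set (E d)) (F : E d → SymMat d) (x : E d) : Prop :=
  Tendsto (fun r : ℝ => ⨍⁻ y in Metric.ball x r ∩ Ω, ENNReal.ofReal (frobNorm (F y - F x)) ∂volume)
    (𝓝[>] 0) (𝓝 0)

/-! ### Symmetric gradients -/

/-- The Jacobian matrix `(∂_j v_i)` of `v` on the closure of `Ω`. At boundary points the one-sided
derivative is taken. -/
def jac {d : ℕ} (Ω : Set (E d)) (v : E d → E d) (x : E d) : Matrix (Fin d) (Fin d) ℝ :=
  Matrix.of fun i j => (fderivWithin ℝ v (closure Ω) x (EuclideanSpace.single j 1)) i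

/-- The symmetric gradient `Dv = (∇v + ∇vᵀ) / 2` on the closure of `Ω` (for piecewise smooth `v`:
defined off the mesh skeleton, and on `∂Ω` as the trace from the adjacent cell). -/
def symGrad {d : ℕ} (Ω : Set (E d)) (v : E d → E d) (x : E d) : SymMat d := symPart (jac Ω v x)

/-- `g` belongs to `H¹(Ω)ᵈ` and `G` is (almost everywhere in `Ω`) its weak symmetric gradient. -/
def IsH1WithSymGrad {d : ℕ} (Ω : Set (E d)) (g : E d → E d) (G : E d → SymMat d) : Prop :=
  MemLp g 2 (volume.restrict Ω) ∧
  ∃ J : E d → Matrix (Fin d) (Fin d) ℝ,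
    (∀ i j, MemLp (fun x => J x i j) 2 (volume.restrict Ω)) ∧
    (∀ φ : E d → ℝ, ContDiff ℝ ∞ φ → HasCompactSupport φ → tsupport φ ⊆ Ω → ∀ i j,
      ∫ x in Ω, g x i * fderiv ℝ φ x (EuclideanSpace.single j 1)
        = -∫ x in Ω, J x i j * φ x) ∧
    ∀ᵐ x ∂(volume.restrict Ω), G x = symPart (J x)

/-! ### Meshes and finite element functions -/

/-- The two reference cells. -/
inductive RefShape
  | simplex
  | cube

/-- The unit simplex and the unit cube. -/
def RefShape.toSet (d : ℕ) : RefShape → Set (E d)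
  | .simplex => {x | (∀ i, 0 ≤ x i) ∧ ∑ i, x i ≤ 1}
  | .cube => {x | ∀ i, 0 ≤ x i ∧ x i ≤ 1}

/-- On `K`, the components of `f` are polynomials of total degree at most `k`. -/
def IsPolyOn {d : ℕ} (k : ℕ) (K : Set (E d)) (f : E d → E d) : Prop :=
  ∃ P : Fin d → MvPolynomial (Fin d) ℝ, (∀ i, (P i).totalDegree ≤ k) ∧
    ∀ x ∈ K, ∀ i, f x i = MvPolynomial.eval (fun j => x j) (P i)

/-- A finite family of cells, given as images of reference cells. -/
structure Mesh (d : ℕ) where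
  Cell : Type
  finite : Finite Cell
  shape : Cell → RefShape
  map : Cell → E d → E d

namespace Mesh

variable {d : ℕ} (M : Mesh d)

/-- The reference cell of a cell. -/
def ref (c : M.Cell) : Set (E d) := (M.shape c).toSet d

/-- The (closed) cell as a set. -/
def cell (c : M.Cell) : Set (E d) := M.map c '' M.ref c

/-- The element diameter `h_T`. -/
def diam (c : M.Cell) : ℝ := Metric.diam (M.cell c)

/-- `M` is a mesh of `Ω` with cell maps of polynomial degree at most `m` and shape-regularity
constant `κ`: the closed cells cover the closure of `Ω`, their interiors are pairwise disjoint, the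
cell maps are injective, and on the reference cell their derivative and its inverse are bounded by
`κ h_T` and `κ / h_T`. -/
structure IsShapeRegular (Ω : Set (E d)) (m : ℕ) (κ : ℝ) : Prop where
  cover : ⋃ c, M.cell c = closure Ω
  disjoint : Pairwise fun c c' => Disjoint (interior (M.cell c)) (interior (M.cell c'))
  map_poly : ∀ c, IsPolyOn m univ (M.map c)
  map_inj : ∀ c, InjOn (M.map c) (M.ref c)
  deriv_le : ∀ c, ∀ x ∈ M.ref c, ‖fderiv ℝ (M.map c) x‖ ≤ κ * M.diam c
  le_deriv : ∀ c, ∀ x ∈ M.ref c, ∀ w, M.diam c * ‖w‖ ≤ κ * ‖fderiv ℝ (M.map c) x w‖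

/-- `v` is a conforming finite element function of degree at most `k`: on every closed cell it is a
polynomial of degree at most `k` in the reference coordinates. As `v` is single-valued on
interfaces, it is continuous on the closure of `Ω`, hence in `H¹(Ω)ᵈ`. -/
def IsFEFunction (k : ℕ) (v : E d → E d) : Prop :=
  ∀ c, IsPolyOn k (M.ref c) (v ∘ M.map c)

/-- `hΓ` is a local mesh size on the boundary portion `Γ`: it is measurable and, up to the factor
`κ`, equal to the diameter of the cell at hand. -/
def IsBoundaryMeshSize (Γ : Set (E d)) (κ : ℝ) (hΓ : E d → ℝ) : Prop :=
  AEMeasurable hΓ ((surf d).restrict Γ) ∧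
  ∀ᵐ x ∂((surf d).restrict Γ), 0 < hΓ x ∧
    ∀ c, x ∈ M.cell c → hΓ x ≤ κ * M.diam c ∧ M.diam c ≤ κ * hΓ x

end Mesh

/-! ### The linearized viscous-Nitsche form and the norms -/

/-- The linearized viscous-Nitsche form
`(T(Dv), Dw) - (T(Dv) n, w)_Γ - (v, DS(G)[Dw] n)_Γ + γ₁ (h⁻¹ η(G) v, w)_Γ
  + γ₂ (h⁻¹ v·n, w·n)_Γ`. -/
def nitscheForm {d : ℕ} (R : Rheology) (Ω Γ : Set (E d)) (hΓ : E d → ℝ)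
    (T : E d → SymMat d →ₗ[ℝ] SymMat d) (G : E d → SymMat d) (γ₁ γ₂ : ℝ) (v w : E d → E d) : ℝ :=
  (∫ x in Ω, frob (T x (symGrad Ω v x)) (symGrad Ω w x))
    - (∫ x in Γ, normalPairing (T x (symGrad Ω v x)) (outerNormal Ω x) (w x) ∂(surf d))
    - (∫ x in Γ, normalPairing (R.dStress (G x) (symGrad Ω w x)) (outerNormal Ω x) (v x) ∂(surf d))
    + γ₁ * (∫ x in Γ, (hΓ x)⁻¹ * R.effVisc (G x) * inner ℝ (v x) (w x) ∂(surf d))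
    + γ₂ * (∫ x in Γ, (hΓ x)⁻¹ * (inner ℝ (v x) (outerNormal Ω x)
        * inner ℝ (w x) (outerNormal Ω x)) ∂(surf d))

/-- `‖Dv‖²` in `L²(Ω)`. -/
def symGradSq {d : ℕ} (Ω : Set (E d)) (v : E d → E d) : ℝ :=
  ∫ x in Ω, frobNorm (symGrad Ω v x) ^ 2

/-- `‖h^(-1/2) v‖²` in `L²(Γ)`. -/
def bdrySq {d : ℕ} (Γ : Set (E d)) (hΓ : E d → ℝ) (v : E d → E d) : ℝ :=
  ∫ x in Γ, (hΓ x)⁻¹ * ‖v x‖ ^ 2 ∂(surf d)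

/-- `‖h^(-1/2) v·n‖²` in `L²(Γ)`. -/
def bdryNormalSq {d : ℕ} (Ω Γ : Set (E d)) (hΓ : E d → ℝ) (v : E d → E d) : ℝ :=
  ∫ x in Γ, (hΓ x)⁻¹ * (inner ℝ (v x) (outerNormal Ω x)) ^ 2 ∂(surf d)

/-- The squared `H¹(Ω)` norm `‖v‖² + ‖∇v‖²`. -/
def h1Sq {d : ℕ} (Ω : Set (E d)) (v : E d → E d) : ℝ :=
  (∫ x in Ω, ‖v x‖ ^ 2) + ∫ x in Ω, ∑ i, ∑ j, jac Ω v x i j ^ 2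

/-- The constitutive tangent field `T` (on `Ω`, with traces on `Γ`), the lifting `g` and its
symmetric gradient `G` (on `Ω`, with traces on `Γ`), and the tangent bounds almost everywhere
in `Ω`. -/
structure IsNewtonData {d : ℕ} (R : Rheology) (Ω Γ : Set (E d)) (ηbar : ℝ)
    (T : E d → SymMat d →ₗ[ℝ] SymMat d) (g : E d → E d) (G : E d → SymMat d) : Prop where
  tangent_meas : ∀ B, AEStronglyMeasurable (fun x => T x B) (volume.restrict Ω)
  tangent_meas_bdry : ∀ B, AEStronglyMeasurable (fun x => T x B) ((surf d).restrict Γ)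
  tangent_trace : ∀ᵐ x ∂((surf d).restrict Γ), ∀ B, HasTraceAt Ω (fun y => T y B) x
  lifting : IsH1WithSymGrad Ω g G
  lifting_meas_bdry : AEStronglyMeasurable G ((surf d).restrict Γ)
  lifting_trace : ∀ᵐ x ∂((surf d).restrict Γ), HasTraceAt Ω G x
  bounds : ∀ᵐ x ∂(volume.restrict Ω), R.TangentBounds ηbar (T x) (G x)

end

end NitscheNS

open NitscheNS

/-! Part (c): the three tangents are one family, `dampedTangent τ` with `τ ∈ [0,1]`. Since `1 < p <
2`, the rank-one correction is negative but, by Cauchy–Schwarz, at most `μ(A)|B|²` in size, so the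
shear part of the viscosity absorbs it and `ν_∞|B|²` survives. The upper bound uses `μ ≤ ν δ^(p-2)`.

Part (a): the volume term gives `ν_∞‖Dv‖²` and the penalty at least `γ₁ν_∞‖h^(-1/2)v‖²`, because `η
≥ ν_∞`. Each of the two consistency terms is at most the boundary integral of `ηbar |Dv| |v|`; here
the upper tangent bound is carried to the boundary by traces (`IsNewtonData.bound_trace`). Young's
inequality and the discrete trace inequality (`exists_trace_inequality`) let both terms together
cost half of the volume term plus a multiple of the boundary term. The trace inequality rests on a
pointwise inverse estimate (`exists_inverse_estimate`): on the reference cell, `det DF` times the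
pulled-back `Dv` is a polynomial of controlled degree, so all norms on a finite-dimensional space
compare, and shape regularity gives the scaling.

Part (b): the threshold on `γ₁` keeps half of the penalty. For the `H¹` bound, a Korn inequality on
`V_h` (`exists_korn`) follows from finite dimensionality once the kernel is known to be trivial. If
`Dv = 0`, then `v` is rigid on each cell, hence rigid on `Ω`; a nonzero rigid motion vanishes at
most on an affine subspace of dimension `d-2`, which has zero surface measure. -/

namespace NitscheNS

/-! ### The Frobenius product as an inner product -/

section Frobenius

variable {d : ℕ}

/-- Matrices as elements of a Euclidean space; the norm is the Frobenius norm. -/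
noncomputable def matVec : Matrix (Fin d) (Fin d) ℝ →ₗ[ℝ] EuclideanSpace ℝ (Fin d × Fin d) where
  toFun A := WithLp.toLp 2 fun q => A q.1 q.2
  map_add' _ _ := rfl
  map_smul' _ _ := rfl

@[simp] theorem matVec_apply (A : Matrix (Fin d) (Fin d) ℝ) (q : Fin d × Fin d) :
    matVec A q = A q.1 q.2 := rfl

theorem norm_matVec_sq (A : Matrix (Fin d) (Fin d) ℝ) :
    ‖matVec A‖ ^ 2 = ∑ i, ∑ j, A i j ^ 2 := by
  rw [EuclideanSpace.norm_sq_eq, Fintype.sum_prod_type]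
  simp

/-- Symmetric matrices as elements of a Euclidean space. -/
noncomputable def symVec : SymMat d →ₗ[ℝ] EuclideanSpace ℝ (Fin d × Fin d) :=
  matVec ∘ₗ (SymMat d).subtype

@[simp] theorem symVec_apply (A : SymMat d) (q : Fin d × Fin d) : symVec A q = A.1 q.1 q.2 := rfl

theorem frob_eq_inner (A B : SymMat d) : frob A B = inner ℝ (symVec A) (symVec B) := by
  simp only [frob, PiLp.inner_apply, Fintype.sum_prod_type, symVec_apply, RCLike.inner_apply,
    conj_trivial]
  exact Finset.sum_congr rfl fun i _ => Finset.sum_congr rfl fun j _ => mul_comm _ _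

theorem frobNorm_eq_norm (A : SymMat d) : frobNorm A = ‖symVec A‖ := by
  rw [frobNorm, frob_eq_inner, real_inner_self_eq_norm_sq, Real.sqrt_sq (norm_nonneg _)]

theorem frobNorm_nonneg (A : SymMat d) : 0 ≤ frobNorm A := Real.sqrt_nonneg _

theorem frobNorm_sq (A : SymMat d) : frobNorm A ^ 2 = frob A A := by
  rw [frobNorm, Real.sq_sqrt (Rheology.frob_self_nonneg A)]

theorem frobNorm_sq_eq_sum (A : SymMat d) : frobNorm A ^ 2 = ∑ i, ∑ j, A.1 i j ^ 2 := by
  rw [frobNorm_sq, frob]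
  exact Finset.sum_congr rfl fun i _ => Finset.sum_congr rfl fun j _ => (sq _).symm

theorem abs_frob_le (A B : SymMat d) : |frob A B| ≤ frobNorm A * frobNorm B := by
  rw [frob_eq_inner, frobNorm_eq_norm, frobNorm_eq_norm]
  exact abs_real_inner_le_norm _ _

theorem frobNorm_add_le (A B : SymMat d) : frobNorm (A + B) ≤ frobNorm A + frobNorm B := by
  simp only [frobNorm_eq_norm, map_add]
  exact norm_add_le _ _

theorem frobNorm_smul (c : ℝ) (A : SymMat d) : frobNorm (c • A) = |c| * frobNorm A := by
  simp only [frobNorm_eq_norm, map_smul, norm_smul, Real.norm_eq_abs]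

theorem frob_add_left (A B C : SymMat d) : frob (A + B) C = frob A C + frob B C := by
  simp only [frob_eq_inner, map_add, inner_add_left]

theorem frob_smul_left (c : ℝ) (A B : SymMat d) : frob (c • A) B = c * frob A B := by
  simp only [frob_eq_inner, map_smul, real_inner_smul_left]

/-- The pairing is the Frobenius product of `A` with the rank-one matrix `w ⊗ n`, whose norm is
`|w||n|`, so Cauchy–Schwarz gives constant one. -/
theorem abs_normalPairing_le (A : SymMat d) (n w : E d) :
    |normalPairing A n w| ≤ frobNorm A * ‖n‖ * ‖w‖ := by
  set u : EuclideanSpace ℝ (Fin d × Fin d) := WithLp.toLp 2 fun q => w q.1 * n q.2 with hu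
  have h1 : normalPairing A n w = inner ℝ (symVec A) u := by
    simp only [normalPairing, PiLp.inner_apply, Fintype.sum_prod_type, symVec_apply,
      RCLike.inner_apply, conj_trivial, Finset.sum_mul, hu]
    exact Finset.sum_congr rfl fun i _ => Finset.sum_congr rfl fun j _ => by ring
  have h2 : ‖u‖ = ‖w‖ * ‖n‖ := by
    rw [← sq_eq_sq₀ (norm_nonneg _) (by positivity), mul_pow, EuclideanSpace.norm_sq_eq,
      EuclideanSpace.norm_sq_eq, EuclideanSpace.norm_sq_eq, Fintype.sum_prod_type,
      Finset.sum_mul_sum]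
    simp [hu, mul_pow]
  rw [h1, frobNorm_eq_norm]
  refine (abs_real_inner_le_norm _ _).trans_eq ?_
  rw [h2]; ring

theorem symVec_injective : Function.Injective (symVec (d := d)) := by
  intro A B h
  ext i j
  exact congrFun (congrArg WithLp.ofLp h) (i, j)

theorem frobNorm_eq_zero {A : SymMat d} (h : frobNorm A = 0) : A = 0 := by
  rw [frobNorm_eq_norm, norm_eq_zero] at h
  exact symVec_injective (h.trans (map_zero _).symm)

theorem continuous_frob : Continuous fun q : SymMat d × SymMat d => frob q.1 q.2 := by
  unfold frob
  refine continuous_finsetSum _ fun i _ => continuous_finsetSum _ fun j _ => ?_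
  exact ((continuous_subtype_val.comp continuous_fst).matrix_elem i j).mul
    ((continuous_subtype_val.comp continuous_snd).matrix_elem i j)

theorem continuous_frobNorm : Continuous (frobNorm (d := d)) :=
  Real.continuous_sqrt.comp (continuous_frob.comp (continuous_id.prodMk continuous_id))

end Frobenius

/-! ### Bounds for the tangents -/

namespace Rheology

variable (R : Rheology) {d : ℕ}

theorem regSq_pos (A : SymMat d) : 0 < R.δ ^ 2 + frob A A := by
  have := R.δ_pos
  have := frob_self_nonneg A
  positivity

theorem shearVisc_pos (A : SymMat d) : 0 < R.shearVisc A :=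
  mul_pos R.ν_pos (Real.rpow_pos_of_pos (R.regSq_pos A) _)

theorem shearVisc_le (A : SymMat d) : R.shearVisc A ≤ R.ν * (R.δ ^ 2) ^ ((R.p - 2) / 2) := by
  refine mul_le_mul_of_nonneg_left ?_ R.ν_pos.le
  refine Real.rpow_le_rpow_of_nonpos (by have := R.δ_pos; positivity) ?_
    (by linarith [R.p_lt_two])
  linarith [frob_self_nonneg A]

theorem effVisc_pos (A : SymMat d) : 0 < R.effVisc A := add_pos R.νInf_pos (R.shearVisc_pos A)

/-- The common form of the tangents: `τ = 0` is the Picard tangent, `τ = 1` the Newton tangent. -/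
noncomputable def dampedTangent (τ : ℝ) (A : SymMat d) : SymMat d →ₗ[ℝ] SymMat d :=
  R.effVisc A • LinearMap.id
    + (τ * ((R.p - 2) * R.shearVisc A / (R.δ ^ 2 + frob A A))) • rankOne A

theorem dampedTangent_apply (τ : ℝ) (A B : SymMat d) : R.dampedTangent τ A B =
    R.effVisc A • B
      + (τ * ((R.p - 2) * R.shearVisc A / (R.δ ^ 2 + frob A A))) • (frob A B • A) := rfl

theorem picardTangent_eq (A : SymMat d) : R.picardTangent A = R.dampedTangent 0 A := by
  simp [picardTangent, dampedTangent]

/-- The exponent `(p-4)/2` is `(p-2)/2 - 1`, so the coefficient is `(p-2) μ(A)` divided by `δ² +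
|A|²`. -/
theorem dStress_eq (A : SymMat d) : R.dStress A = R.dampedTangent 1 A := by
  have h : (R.p - 4) / 2 = (R.p - 2) / 2 - 1 := by ring
  rw [dStress, dampedTangent, one_mul, shearVisc, h, Real.rpow_sub_one (R.regSq_pos A).ne']
  congr 2
  ring

/-- With `σ = μ(A) A` the term `(σ : B) σ` carries `μ²`; the `1/μ` in `θ` cancels one factor, and
the clipping factor is left as the damping. -/
theorem modTangent_eq (σmax : ℝ) (A : SymMat d) :
    R.modTangent σmax A = R.dampedTangent (R.clip σmax A) A := by
  rw [modTangent, dampedTangent]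
  congr 1
  ext1 B
  have h1 := (R.shearVisc_pos A).ne'
  have h2 := (R.regSq_pos A).ne'
  simp only [LinearMap.smul_apply, rankOne, LinearMap.coe_mk, AddHom.coe_mk, frob_smul_left,
    smul_smul]
  congr 1
  field_simp

theorem clip_mem {σmax : ℝ} (h : 0 ≤ σmax) (A : SymMat d) : R.clip σmax A ∈ Icc (0 : ℝ) 1 := by
  rw [clip]
  split_ifs with h0
  · simp
  · exact ⟨le_min zero_le_one (div_nonneg h (frobNorm_nonneg _)), min_le_left _ _⟩

/-- The rank-one term equals `-τ(2-p) μ(A) z` with `z = (A:B)²/(δ²+|A|²) ≤ |B|²`. As `τ(2-p) ≤ 1`,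
it is absorbed by `μ(A)|B|²`, and exactly the `ν_∞` part remains. -/
theorem dampedTangent_coercive {τ : ℝ} (hτ : τ ∈ Icc (0 : ℝ) 1) (A B : SymMat d) :
    R.νInf * frobNorm B ^ 2 ≤ frob (R.dampedTangent τ A B) B := by
  have hq := R.regSq_pos A
  have hμ := R.shearVisc_pos A
  have hp1 := R.one_lt_p
  have hp2 := R.p_lt_two
  have hδ := R.δ_pos
  rw [dampedTangent_apply, frob_add_left, frob_smul_left, frob_smul_left, frob_smul_left,
    ← frobNorm_sq, effVisc]
  have hcs : frob A B ^ 2 ≤ (R.δ ^ 2 + frob A A) * frobNorm B ^ 2 := by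
    have h1 : frob A B ^ 2 ≤ (frobNorm A * frobNorm B) ^ 2 := by
      rw [← sq_abs (frob A B)]
      exact pow_le_pow_left₀ (abs_nonneg _) (abs_frob_le A B) 2
    rw [mul_pow, frobNorm_sq A] at h1
    nlinarith [sq_nonneg (frobNorm B), sq_nonneg R.δ, mul_nonneg (sq_nonneg R.δ)
      (sq_nonneg (frobNorm B))]
  have h2 : frob A B ^ 2 / (R.δ ^ 2 + frob A A) ≤ frobNorm B ^ 2 := by
    rw [div_le_iff₀ hq]; linarith
  set z := frob A B ^ 2 / (R.δ ^ 2 + frob A A) with hz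
  have hz0 : 0 ≤ z := by positivity
  have h3 : τ * ((R.p - 2) * R.shearVisc A / (R.δ ^ 2 + frob A A)) * (frob A B * frob A B)
      = -(τ * (2 - R.p) * (R.shearVisc A * z)) := by
    rw [hz]; field_simp; ring
  rw [h3]
  have h4 : τ * (2 - R.p) ≤ 1 := by
    have := mul_le_mul hτ.2 (by linarith : 2 - R.p ≤ 1) (by linarith) zero_le_one
    linarith
  have h5 : τ * (2 - R.p) * (R.shearVisc A * z) ≤ 1 * (R.shearVisc A * frobNorm B ^ 2) :=
    mul_le_mul h4 (mul_le_mul_of_nonneg_left h2 hμ.le) (by positivity) zero_le_one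
  linarith

theorem frobNorm_dampedTangent_le {τ : ℝ} (hτ : τ ∈ Icc (0 : ℝ) 1) (A B : SymMat d) :
    frobNorm (R.dampedTangent τ A B)
      ≤ (R.νInf + 2 * (R.ν * (R.δ ^ 2) ^ ((R.p - 2) / 2))) * frobNorm B := by
  have hq := R.regSq_pos A
  have hμ := R.shearVisc_pos A
  have hp1 := R.one_lt_p
  have hp2 := R.p_lt_two
  have hB := frobNorm_nonneg B
  have hA := frobNorm_nonneg A
  have hμle := R.shearVisc_le A
  rw [dampedTangent_apply]
  refine (frobNorm_add_le _ _).trans ?_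
  rw [frobNorm_smul, frobNorm_smul, frobNorm_smul, abs_of_pos (R.effVisc_pos A), abs_mul,
    abs_div, abs_mul, abs_of_nonneg hτ.1, abs_of_pos hμ, abs_of_pos hq,
    abs_of_nonpos (by linarith : R.p - 2 ≤ 0), effVisc]
  have h1 : |frob A B| * frobNorm A ≤ (R.δ ^ 2 + frob A A) * frobNorm B := by
    have := mul_le_mul_of_nonneg_right (abs_frob_le A B) hA
    have h2 := frobNorm_sq A
    nlinarith [mul_nonneg (sq_nonneg R.δ) hB]
  have h2 : τ * (-(R.p - 2) * R.shearVisc A / (R.δ ^ 2 + frob A A)) * (|frob A B| * frobNorm A)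
      ≤ R.shearVisc A * frobNorm B := by
    have h3 : τ * (-(R.p - 2)) ≤ 1 := by
      have := mul_le_mul hτ.2 (by linarith : -(R.p - 2) ≤ 1) (by linarith) zero_le_one
      linarith
    calc τ * (-(R.p - 2) * R.shearVisc A / (R.δ ^ 2 + frob A A)) * (|frob A B| * frobNorm A)
        = (τ * (-(R.p - 2))) * (R.shearVisc A * ((|frob A B| * frobNorm A)
            / (R.δ ^ 2 + frob A A))) := by field_simp
      _ ≤ 1 * (R.shearVisc A * frobNorm B) := by
          refine mul_le_mul h3 (mul_le_mul_of_nonneg_left ?_ hμ.le) (by positivity) zero_le_one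
          rw [div_le_iff₀ hq]; linarith
      _ = _ := one_mul _
  nlinarith

/-- The outer factor two in the constant counts the tangent and `DS(G)`, each bounded by the same
norm estimate. -/
theorem tangentBounds_dampedTangent {τ : ℝ} (hτ : τ ∈ Icc (0 : ℝ) 1) (A G : SymMat d) :
    R.TangentBounds (2 * (R.νInf + 2 * (R.ν * (R.δ ^ 2) ^ ((R.p - 2) / 2))))
      (R.dampedTangent τ A) G := by
  intro B
  refine ⟨R.dampedTangent_coercive hτ A B, ?_⟩
  have h1 := R.frobNorm_dampedTangent_le hτ A B
  have h2 := R.frobNorm_dampedTangent_le (τ := 1) (by simp) G B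
  rw [R.dStress_eq]
  linarith

theorem exists_tangentBounds (d : ℕ) : ∃ ηbar : ℝ, R.νInf ≤ ηbar ∧
    ∀ σmax : ℝ, 0 ≤ σmax → ∀ A G : SymMat d,
      R.TangentBounds ηbar (R.picardTangent A) G ∧
      R.TangentBounds ηbar (R.dStress A) G ∧
      R.TangentBounds ηbar (R.modTangent σmax A) G := by
  refine ⟨2 * (R.νInf + 2 * (R.ν * (R.δ ^ 2) ^ ((R.p - 2) / 2))), ?_,
    fun σmax hσ A G => ⟨?_, ?_, ?_⟩⟩
  rotate_left
  · rw [picardTangent_eq]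
    exact R.tangentBounds_dampedTangent (by simp) A G
  · rw [dStress_eq]
    exact R.tangentBounds_dampedTangent (by simp) A G
  · rw [modTangent_eq]
    exact R.tangentBounds_dampedTangent (R.clip_mem hσ A) A G
  · have h1 := R.νInf_pos
    have h2 := R.ν_pos
    have h3 := R.δ_pos
    have h4 : 0 < R.ν * (R.δ ^ 2) ^ ((R.p - 2) / 2) := by positivity
    linarith

theorem continuous_shearVisc : Continuous (R.shearVisc (d := d)) := by
  unfold shearVisc
  refine continuous_const.mul (Continuous.rpow_const ?_ fun A => Or.inl (R.regSq_pos A).ne')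
  exact continuous_const.add (continuous_frob.comp (continuous_id.prodMk continuous_id))

theorem continuous_effVisc : Continuous (R.effVisc (d := d)) :=
  continuous_const.add R.continuous_shearVisc

theorem continuous_dStress_apply (B : SymMat d) : Continuous fun A : SymMat d => R.dStress A B := by
  have hf : Continuous fun A : SymMat d => frob A B :=
    continuous_frob.comp (continuous_id.prodMk continuous_const)
  simp only [dStress_eq, dampedTangent_apply]
  have h2 : Continuous fun A : SymMat d => frob A B • A := hf.smul continuous_id
  have h3 : Continuous fun A : SymMat d =>
      1 * ((R.p - 2) * R.shearVisc A / (R.δ ^ 2 + frob A A)) := by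
    refine continuous_const.mul ((continuous_const.mul R.continuous_shearVisc).div ?_
      fun A => (R.regSq_pos A).ne')
    exact continuous_const.add (continuous_frob.comp (continuous_id.prodMk continuous_id))
  exact (R.continuous_effVisc.smul continuous_const).add (h3.smul h2)

end Rheology


/-! ### Traces of the tangent bounds -/

section Traces

variable {d : ℕ} {Ω : Set (E d)}

theorem tendsto_of_frobNorm_sub {ι : Type*} {l : Filter ι} {F : ι → SymMat d} {A : SymMat d}
    (h : Tendsto (fun i => frobNorm (F i - A)) l (𝓝 0)) : Tendsto F l (𝓝 A) := by
  rw [tendsto_subtype_rng]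
  refine tendsto_pi_nhds.2 fun i => tendsto_pi_nhds.2 fun j => ?_
  rw [tendsto_iff_norm_sub_tendsto_zero]
  refine squeeze_zero (fun _ => norm_nonneg _) (fun t => ?_) h
  rw [frobNorm_eq_norm]
  exact PiLp.norm_apply_le (symVec (F t - A)) (i, j)

/-- Two boundary traces are attained simultaneously along a sequence that avoids a null set. -/
theorem exists_seq_of_hasTraceAt (hΩ : IsOpen Ω) {x : E d} (hx : x ∈ closure Ω)
    {F₁ F₂ : E d → SymMat d} (h₁ : HasTraceAt Ω F₁ x) (h₂ : HasTraceAt Ω F₂ x)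
    (m₁ : AEStronglyMeasurable F₁ (volume.restrict Ω))
    (m₂ : AEStronglyMeasurable F₂ (volume.restrict Ω)) {P : E d → Prop}
    (hP : ∀ᵐ y ∂(volume.restrict Ω), P y) :
    ∃ y : ℕ → E d, (∀ n, P (y n)) ∧ Tendsto (fun n => F₁ (y n)) atTop (𝓝 (F₁ x)) ∧
      Tendsto (fun n => F₂ (y n)) atTop (𝓝 (F₂ x)) := by
  -- Adding the two deviations makes a single point good for both fields at once.
  set f : E d → ENNReal := fun y =>
    ENNReal.ofReal (frobNorm (F₁ y - F₁ x)) + ENNReal.ofReal (frobNorm (F₂ y - F₂ x)) with hf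
  have hm : ∀ F : E d → SymMat d, AEStronglyMeasurable F (volume.restrict Ω) →
      AEMeasurable (fun y => ENNReal.ofReal (frobNorm (F y - F x))) (volume.restrict Ω) :=
    fun F hF => ((continuous_frobNorm.comp (continuous_id.sub continuous_const)
      ).comp_aestronglyMeasurable hF).aemeasurable.ennreal_ofReal
  have hsum : Tendsto (fun r : ℝ => ⨍⁻ y in Metric.ball x r ∩ Ω, f y ∂volume) (𝓝[>] 0) (𝓝 0) := by
    have := h₁.add h₂
    rw [add_zero] at this
    refine this.congr fun r => ?_
    rw [laverage_eq, laverage_eq, laverage_eq, ← ENNReal.add_div, lintegral_add_left'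
      ((hm _ m₁).mono_measure (Measure.restrict_mono inter_subset_right le_rfl))]
  have hseq := hsum.comp (tendsto_nhdsWithin_iff.2 ⟨tendsto_one_div_add_atTop_nhds_zero_nat,
    Eventually.of_forall fun n => show (0 : ℝ) < 1 / ((n : ℝ) + 1) by positivity⟩)
  -- Off any null set some value lies below the mean; the mean is over a set of positive measure
  -- because `x` is in the closure of the open set `Ω`.
  have hex : ∀ n : ℕ, ∃ y, P y ∧
      f y ≤ ⨍⁻ y in Metric.ball x (1 / ((n : ℝ) + 1)) ∩ Ω, f y ∂volume := by
    intro n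
    set B := Metric.ball x (1 / ((n : ℝ) + 1)) with hB
    have hle : volume.restrict (B ∩ Ω) ≤ volume.restrict Ω :=
      Measure.restrict_mono inter_subset_right le_rfl
    have hfin : IsFiniteMeasure (volume.restrict (B ∩ Ω)) := by
      refine isFiniteMeasure_restrict.2 (ne_top_of_le_ne_top ?_ (measure_mono inter_subset_left))
      exact measure_ball_lt_top.ne
    have hne : (volume.restrict (B ∩ Ω)) ≠ 0 := by
      rw [Ne, Measure.restrict_eq_zero]
      refine ((Metric.isOpen_ball.inter hΩ).measure_pos volume ?_).ne'
      exact mem_closure_iff.1 hx B Metric.isOpen_ball (Metric.mem_ball_self (by positivity))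
    obtain ⟨y, hy, hy'⟩ := exists_notMem_null_le_laverage hne
      (((hm _ m₁).add (hm _ m₂)).mono_measure hle) (ae_iff.1 (ae_mono hle hP))
    exact ⟨y, not_not.1 hy, hy'⟩
  choose y hyP hy using hex
  have h0 : Tendsto (fun n => f (y n)) atTop (𝓝 0) :=
    tendsto_of_tendsto_of_tendsto_of_le_of_le tendsto_const_nhds hseq (fun _ => zero_le) hy
  have key : ∀ F : E d → SymMat d, (∀ z, ENNReal.ofReal (frobNorm (F z - F x)) ≤ f z) →
      Tendsto (fun n => F (y n)) atTop (𝓝 (F x)) := by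
    intro F hF
    refine tendsto_of_frobNorm_sub ?_
    have h1 : Tendsto (fun n => ENNReal.ofReal (frobNorm (F (y n) - F x))) atTop (𝓝 0) :=
      tendsto_of_tendsto_of_tendsto_of_le_of_le tendsto_const_nhds h0 (fun _ => zero_le)
        fun n => hF _
    have h2 := (ENNReal.tendsto_toReal ENNReal.zero_ne_top).comp h1
    simpa [Function.comp_def, ENNReal.toReal_ofReal (frobNorm_nonneg _)] using h2
  exact ⟨y, hyP, key F₁ fun z => le_self_add, key F₂ fun z => le_add_self⟩

variable {R : Rheology} {Γ : Set (E d)} {ηbar : ℝ} {T : E d → SymMat d →ₗ[ℝ] SymMat d}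
  {g : E d → E d} {G : E d → SymMat d}

theorem continuous_symPart : Continuous (symPart (d := d)) := by
  refine Continuous.subtype_mk ?_ _
  have h : Continuous fun J : Matrix (Fin d) (Fin d) ℝ => J + J.transpose :=
    continuous_id.add continuous_id.matrix_transpose
  exact h.const_smul (1 / 2 : ℝ)

theorem IsH1WithSymGrad.aestronglyMeasurable (h : IsH1WithSymGrad Ω g G) :
    AEStronglyMeasurable G (volume.restrict Ω) := by
  obtain ⟨-, J, hJ, -, hG⟩ := h
  refine AEStronglyMeasurable.congr ?_ (EventuallyEq.symm hG)
  refine continuous_symPart.comp_aestronglyMeasurable ?_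
  have hof : Continuous fun q : Fin d → Fin d → ℝ => Matrix.of q := continuous_id
  have h2 : AEMeasurable (fun x => fun i j => J x i j) (volume.restrict Ω) :=
    aemeasurable_pi_lambda _ fun i => aemeasurable_pi_lambda _ fun j => (hJ i j).1.aemeasurable
  exact hof.comp_aestronglyMeasurable h2.aestronglyMeasurable

/-- The upper tangent bound holds for the traces. -/
theorem IsNewtonData.bound_trace (h : IsNewtonData R Ω Γ ηbar T g G) (hΩ : IsOpen Ω)
    (hΓ : Γ ⊆ closure Ω) (hΓm : MeasurableSet Γ) : ∀ᵐ x ∂((surf d).restrict Γ), ∀ B : SymMat d,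
      frobNorm (T x B) + frobNorm (R.dStress (G x) B) ≤ ηbar * frobNorm B := by
  filter_upwards [h.tangent_trace, h.lifting_trace, ae_restrict_mem hΓm] with x h1 h2 hx B
  -- The sequence may depend on `B`: the exceptional boundary set was fixed before `B` was chosen.
  -- The bound then passes to the limit by continuity of `DS(·)[B]`.
  obtain ⟨y, hyP, hy1, hy2⟩ := exists_seq_of_hasTraceAt hΩ (hΓ hx) (h1 B) h2 (h.tangent_meas B)
    h.lifting.aestronglyMeasurable h.bounds
  refine le_of_tendsto (x := atTop) ?_ (Eventually.of_forall fun n : ℕ => (hyP n B).2)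
  exact ((continuous_frobNorm.tendsto _).comp hy1).add
    ((continuous_frobNorm.tendsto _).comp (((R.continuous_dStress_apply B).tendsto _).comp hy2))

end Traces


/-! ### Linear maps of finite rank -/

section FiniteRank

variable {V X Y : Type*} [AddCommGroup V] [Module ℝ V]

theorem exists_comp_rangeRestrict [AddCommGroup X] [Module ℝ X] [AddCommGroup Y] [Module ℝ Y]
    (A : V →ₗ[ℝ] X) (B : V →ₗ[ℝ] Y) (h : LinearMap.ker A ≤ LinearMap.ker B) :
    ∃ L : LinearMap.range A →ₗ[ℝ] Y, ∀ v, L ⟨A v, v, rfl⟩ = B v := by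
  refine ⟨(LinearMap.ker A).liftQ B h ∘ₗ A.quotKerEquivRange.symm.toLinearMap, fun v => ?_⟩
  have : A.quotKerEquivRange.symm ⟨A v, v, rfl⟩ = (LinearMap.ker A).mkQ v := by
    rw [LinearEquiv.symm_apply_eq]
    rfl
  simp [this]

theorem finiteDimensional_range_of_ker_le [AddCommGroup X] [Module ℝ X] [AddCommGroup Y]
    [Module ℝ Y] (A : V →ₗ[ℝ] X) (B : V →ₗ[ℝ] Y) (h : LinearMap.ker A ≤ LinearMap.ker B)
    [FiniteDimensional ℝ (LinearMap.range A)] : FiniteDimensional ℝ (LinearMap.range B) := by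
  obtain ⟨L, hL⟩ := exists_comp_rangeRestrict A B h
  have : LinearMap.range B ≤ LinearMap.range L := by
    rintro _ ⟨v, rfl⟩
    exact ⟨_, hL v⟩
  exact Submodule.finiteDimensional_of_le this

/-- Equivalence of norms for seminorms: `B` factors through the range of `A`, and a linear map on a
finite-dimensional normed space is bounded. Only the range, not `V`, has to be finite-dimensional.
-/
theorem exists_norm_le_of_ker_le [NormedAddCommGroup X] [NormedSpace ℝ X] [NormedAddCommGroup Y]
    [NormedSpace ℝ Y] (A : V →ₗ[ℝ] X) (B : V →ₗ[ℝ] Y) (h : LinearMap.ker A ≤ LinearMap.ker B)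
    [FiniteDimensional ℝ (LinearMap.range A)] : ∃ C : ℝ, 0 < C ∧ ∀ v, ‖B v‖ ≤ C * ‖A v‖ := by
  obtain ⟨L, hL⟩ := exists_comp_rangeRestrict A B h
  refine ⟨‖LinearMap.toContinuousLinearMap L‖ + 1, by positivity, fun v => ?_⟩
  have h1 := (LinearMap.toContinuousLinearMap L).le_opNorm ⟨A v, v, rfl⟩
  rw [LinearMap.coe_toContinuousLinearMap', hL] at h1
  refine h1.trans (mul_le_mul_of_nonneg_right (by linarith) (norm_nonneg _))

variable {α F : Type*} [MeasurableSpace α] [NormedAddCommGroup F] [InnerProductSpace ℝ F]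

/-- A family of square integrable functions, linear up to null sets, as a map to `L²`. -/
noncomputable def toL2 (μ : Measure α) (f : V → α → F) (hf : ∀ v, MemLp (f v) 2 μ)
    (hadd : ∀ v w, f (v + w) =ᵐ[μ] f v + f w) (hsmul : ∀ (c : ℝ) v, f (c • v) =ᵐ[μ] c • f v) :
    V →ₗ[ℝ] Lp F 2 μ where
  toFun v := (hf v).toLp (f v)
  map_add' v w := by
    rw [← MemLp.toLp_add]
    exact MemLp.toLp_congr _ _ (hadd v w)
  map_smul' c v := by
    rw [RingHom.id_apply, ← MemLp.toLp_const_smul]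
    exact MemLp.toLp_congr _ _ (hsmul c v)

variable {μ : Measure α} {f : V → α → F} {hf : ∀ v, MemLp (f v) 2 μ}
  {hadd : ∀ v w, f (v + w) =ᵐ[μ] f v + f w} {hsmul : ∀ (c : ℝ) v, f (c • v) =ᵐ[μ] c • f v}

theorem norm_toL2_sq (v : V) : ‖toL2 μ f hf hadd hsmul v‖ ^ 2 = ∫ x, ‖f v x‖ ^ 2 ∂μ := by
  rw [← real_inner_self_eq_norm_sq, L2.inner_def]
  refine integral_congr_ae ?_
  filter_upwards [(hf v).coeFn_toLp] with x hx
  rw [← real_inner_self_eq_norm_sq]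
  change inner ℝ ((hf v).toLp (f v) x) ((hf v).toLp (f v) x) = _
  rw [hx]

theorem toL2_eq_zero (v : V) : toL2 μ f hf hadd hsmul v = 0 ↔ f v =ᵐ[μ] 0 := by
  have h : toL2 μ f hf hadd hsmul v =ᵐ[μ] f v := (hf v).coeFn_toLp
  rw [Lp.eq_zero_iff_ae_eq_zero]
  exact ⟨fun h' => h.symm.trans h', fun h' => h.trans h'⟩

end FiniteRank

/-! ### Equivalence of norms on polynomials -/

section Polynomials

variable {d : ℕ}

theorem continuous_polyEval (p : MvPolynomial (Fin d) ℝ) :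
    Continuous fun x : E d => MvPolynomial.eval (fun j => x j) p := by
  have h : Continuous fun x : E d => fun j => x j := by fun_prop
  exact (MvPolynomial.continuous_eval p).comp h

/-- On a compact regular set, the maximum of a polynomial is bounded by its `L²` norm. -/
theorem exists_poly_sq_le {S : Set (E d)} (hS : IsCompact S) (hS' : S ⊆ closure (interior S))
    (n : ℕ) : ∃ C : ℝ, 0 < C ∧ ∀ p : MvPolynomial (Fin d) ℝ, p.totalDegree ≤ n → ∀ x ∈ S,
      MvPolynomial.eval (fun j => x j) p ^ 2
        ≤ C * ∫ y in interior S, MvPolynomial.eval (fun j => y j) p ^ 2 := by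
  have : CompactSpace S := isCompact_iff_compactSpace.1 hS
  have hfin : IsFiniteMeasure ((volume : Measure (E d)).restrict (interior S)) := by
    refine isFiniteMeasure_restrict.2 (ne_top_of_le_ne_top ?_ (measure_mono interior_subset))
    exact hS.measure_lt_top.ne
  let V := MvPolynomial.restrictTotalDegree (Fin d) ℝ n
  let B : V →ₗ[ℝ] C(S, ℝ) :=
    { toFun := fun p => ⟨fun x => MvPolynomial.eval (fun j => x.1 j) p.1,
        (continuous_polyEval p.1).comp continuous_subtype_val⟩
      map_add' := fun p q => by ext x; simp
      map_smul' := fun c p => by ext x; simp [MvPolynomial.smul_eval] }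
  let A : V →ₗ[ℝ] Lp ℝ 2 ((volume : Measure (E d)).restrict (interior S)) :=
    toL2 _ (fun p x => MvPolynomial.eval (fun j => x j) p.1)
      (fun p => by
        refine MemLp.of_bound (continuous_polyEval p.1).aestronglyMeasurable ‖B p‖ ?_
        filter_upwards [ae_restrict_mem isOpen_interior.measurableSet] with x hx
        exact (B p).norm_coe_le_norm ⟨x, interior_subset hx⟩)
      (fun p q => Eventually.of_forall fun x => by simp)
      (fun c p => Eventually.of_forall fun x => by simp [MvPolynomial.smul_eval])
  -- A polynomial that vanishes almost everywhere on the interior vanishes there by continuity, and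
  -- then on `S`, which lies in the closure of its interior.
  have hker : LinearMap.ker A ≤ LinearMap.ker B := by
    intro p hp
    rw [LinearMap.mem_ker] at hp ⊢
    have h0 : (fun x : E d => MvPolynomial.eval (fun j => x j) p.1)
        =ᵐ[volume.restrict (interior S)] fun _ => 0 := (toL2_eq_zero p).1 hp
    have h1 := Measure.eqOn_open_of_ae_eq h0 isOpen_interior
      (continuous_polyEval p.1).continuousOn continuousOn_const
    have h2 := h1.closure (continuous_polyEval p.1) continuous_const
    ext x
    exact h2 (hS' x.2)
  obtain ⟨C, hC, h⟩ := exists_norm_le_of_ker_le A B hker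
  refine ⟨C ^ 2, by positivity, fun p hp x hx => ?_⟩
  let q : V := ⟨p, (MvPolynomial.mem_restrictTotalDegree _ _ _).2 hp⟩
  have h1 : |MvPolynomial.eval (fun j => x j) p| ≤ C * ‖A q‖ :=
    ((B q).norm_coe_le_norm ⟨x, hx⟩).trans (h q)
  have h2 := pow_le_pow_left₀ (abs_nonneg _) h1 2
  rw [sq_abs, mul_pow, show ‖A q‖ ^ 2 = _ from norm_toL2_sq q] at h2
  simpa only [Real.norm_eq_abs, sq_abs] using h2

end Polynomials

/-! ### Surface measure -/

section Surface

variable {d : ℕ}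

theorem surf_image_le {K : NNReal} {f : E d → E d} {s : Set (E d)} (hf : LipschitzOnWith K f s) :
    surf d (f '' s) ≤ (K : ENNReal) ^ (d - 1) * surf d s := by
  have h := hf.hausdorffMeasure_image_le (d := ((d - 1 : ℕ) : ℝ)) (by positivity)
  rw [ENNReal.rpow_natCast] at h
  simp only [surf, Measure.euclideanHausdorffMeasure_def, Measure.smul_apply, ENNReal.smul_def,
    smul_eq_mul]
  rw [mul_left_comm]
  exact mul_le_mul_right h _

/-- Bounded subsets of hyperplanes have finite surface measure. -/
theorem surf_lt_top_of_subset_hyperplane {s : Set (E d)} (hs : Bornology.IsBounded s) {a : E d}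
    (ha : a ≠ 0) {c : ℝ} (h : ∀ x ∈ s, inner ℝ a x = c) : surf d s < ⊤ := by
  rcases s.eq_empty_or_nonempty with rfl | ⟨x₀, hx₀⟩
  · simp
  let K : Submodule ℝ (E d) := (ℝ ∙ a)ᗮ
  have hK : Module.finrank ℝ K = d - 1 := by
    have h1 := Submodule.finrank_add_finrank_orthogonal (ℝ ∙ a)
    rw [finrank_span_singleton ha, finrank_euclideanSpace, Fintype.card_fin] at h1
    change Module.finrank ℝ ((ℝ ∙ a)ᗮ : Submodule ℝ (E d)) = d - 1
    omega
  -- The translate of `a^⊥` through `x₀` is an isometric copy of a `(d-1)`-dimensional Euclidean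
  -- space, where the measure is Lebesgue and bounded sets are finite.
  let f : K → E d := fun z => x₀ + z.1
  have hf : Isometry f := by
    refine Isometry.of_dist_eq fun y z => ?_
    simp only [f, dist_add_left]
    rfl
  have himg : s ⊆ f '' (f ⁻¹' s) := by
    intro x hx
    refine ⟨⟨x - x₀, ?_⟩, ?_, ?_⟩
    · rw [Submodule.mem_orthogonal_singleton_iff_inner_right, inner_sub_right, h x hx, h x₀ hx₀,
        sub_self]
    · simpa [f] using hx
    · simp [f]
  refine (measure_mono himg).trans_lt ?_
  rw [surf, hf.euclideanHausdorffMeasure_image, ← hK,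
    InnerProductSpace.euclideanHausdorffMeasure_eq_volume]
  exact (hf.antilipschitz.isBounded_preimage hs).measure_lt_top

end Surface

/-! ### Reference cells -/

namespace RefShape

variable {d : ℕ}

theorem toSet_subset_cube (s : RefShape) : s.toSet d ⊆ {x | ∀ i, 0 ≤ x i ∧ x i ≤ 1} := by
  cases s with
  | cube => exact Subset.rfl
  | simplex =>
    rintro x ⟨h0, h1⟩ i
    exact ⟨h0 i, (Finset.single_le_sum (fun j _ => h0 j) (Finset.mem_univ i)).trans h1⟩

theorem isBounded_toSet (s : RefShape) : Bornology.IsBounded (s.toSet d) := by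
  rw [isBounded_iff_forall_norm_le]
  refine ⟨d, fun x hx => ?_⟩
  have h := s.toSet_subset_cube hx
  have h2 : ‖x‖ ^ 2 ≤ (d : ℝ) := by
    rw [EuclideanSpace.norm_sq_eq]
    calc ∑ i, ‖x i‖ ^ 2 ≤ ∑ _i : Fin d, (1 : ℝ) := by
          refine Finset.sum_le_sum fun i _ => ?_
          rw [Real.norm_eq_abs, sq_abs]
          nlinarith [(h i).1, (h i).2]
      _ = d := by simp
  have h3 : (d : ℝ) ≤ (d : ℝ) ^ 2 := by
    have : d ≤ d ^ 2 := Nat.le_self_pow two_ne_zero d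
    exact_mod_cast this
  exact (sq_le_sq₀ (norm_nonneg _) (by positivity)).1 (h2.trans h3)

theorem isClosed_toSet (s : RefShape) : IsClosed (s.toSet d) := by
  cases s with
  | cube =>
    simp only [toSet, ofPred_forall, ofPred_and]
    exact isClosed_iInter fun i => (isClosed_le (by fun_prop) (by fun_prop)).inter
      (isClosed_le (by fun_prop) (by fun_prop))
  | simplex =>
    simp only [toSet, ofPred_forall, ofPred_and]
    exact (isClosed_iInter fun i => isClosed_le (by fun_prop) (by fun_prop)).inter
      (isClosed_le (by fun_prop) (by fun_prop))

theorem isCompact_toSet (s : RefShape) : IsCompact (s.toSet d) :=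
  Metric.isCompact_of_isClosed_isBounded s.isClosed_toSet s.isBounded_toSet

theorem convex_toSet (s : RefShape) : Convex ℝ (s.toSet d) := by
  cases s with
  | cube =>
    intro x hx y hy a b ha hb hab i
    have := hx i
    have := hy i
    simp only [PiLp.add_apply, PiLp.smul_apply, smul_eq_mul]
    constructor <;> nlinarith
  | simplex =>
    intro x hx y hy a b ha hb hab
    refine ⟨fun i => ?_, ?_⟩
    · have := hx.1 i
      have := hy.1 i
      simp only [PiLp.add_apply, PiLp.smul_apply, smul_eq_mul]
      positivity
    · have := hx.2
      have := hy.2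
      simp only [PiLp.add_apply, PiLp.smul_apply, smul_eq_mul, Finset.sum_add_distrib,
        ← Finset.mul_sum]
      nlinarith

/-- The points that satisfy the defining inequalities strictly. -/
def strictSet (d : ℕ) : RefShape → Set (E d)
  | .simplex => {x | (∀ i, 0 < x i) ∧ ∑ i, x i < 1}
  | .cube => {x | ∀ i, 0 < x i ∧ x i < 1}

theorem isOpen_strictSet (s : RefShape) : IsOpen (s.strictSet d) := by
  cases s with
  | cube =>
    simp only [strictSet, ofPred_forall, ofPred_and]
    exact isOpen_iInter_of_finite fun i => (isOpen_lt (by fun_prop) (by fun_prop)).inter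
      (isOpen_lt (by fun_prop) (by fun_prop))
  | simplex =>
    simp only [strictSet, ofPred_forall, ofPred_and]
    exact (isOpen_iInter_of_finite fun i => isOpen_lt (by fun_prop) (by fun_prop)).inter
      (isOpen_lt (by fun_prop) (by fun_prop))

theorem strictSet_subset_interior (s : RefShape) : s.strictSet d ⊆ interior (s.toSet d) := by
  refine interior_maximal ?_ s.isOpen_strictSet
  cases s with
  | cube => exact fun x hx i => ⟨(hx i).1.le, (hx i).2.le⟩
  | simplex => exact fun x hx => ⟨fun i => (hx.1 i).le, hx.2.le⟩

theorem interior_nonempty (s : RefShape) : (interior (s.toSet d)).Nonempty := by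
  refine Set.Nonempty.mono s.strictSet_subset_interior ⟨WithLp.toLp 2 fun _ => 1 / (d + 1 : ℝ), ?_⟩
  have h0 : (0 : ℝ) < 1 / (d + 1 : ℝ) := by positivity
  cases s with
  | cube =>
    refine fun i => ⟨h0, ?_⟩
    have : (0 : ℝ) < d := by exact_mod_cast i.pos
    change 1 / (d + 1 : ℝ) < 1
    rw [div_lt_one (by positivity)]
    linarith
  | simplex =>
    refine ⟨fun i => h0, ?_⟩
    simp only [Finset.sum_const, Finset.card_univ, Fintype.card_fin, nsmul_eq_mul]
    rw [mul_one_div, div_lt_one (by positivity)]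
    linarith

theorem subset_closure_interior (s : RefShape) : s.toSet d ⊆ closure (interior (s.toSet d)) := by
  rw [s.convex_toSet.closure_interior_eq_closure_of_nonempty_interior s.interior_nonempty]
  exact subset_closure

theorem uniqueDiffOn (s : RefShape) : UniqueDiffOn ℝ (s.toSet d) :=
  uniqueDiffOn_convex s.convex_toSet s.interior_nonempty

theorem volume_diff_interior (s : RefShape) : volume (s.toSet d \ interior (s.toSet d)) = 0 := by
  refine measure_mono_null ?_ (s.convex_toSet.addHaar_frontier (μ := volume))
  exact sdiff_subset_sdiff_left subset_closure

/-- The boundary of a reference cell has finite surface measure. -/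
theorem surf_diff_interior_lt_top (s : RefShape) :
    surf d (s.toSet d \ interior (s.toSet d)) < ⊤ := by
  set C : Set (E d) := RefShape.cube.toSet d with hC
  have hb : ∀ P : E d → Prop, Bornology.IsBounded {x ∈ C | P x} := fun P =>
    RefShape.cube.isBounded_toSet.subset (sep_subset _ _)
  -- Hyperplane pieces containing the faces of both shapes. The clause `0 < d` keeps the normal `(1,
  -- …, 1)` of the slanted face nonzero.
  set H : Set (E d) := (⋃ i : Fin d, {x ∈ C | x i = 0} ∪ {x ∈ C | x i = 1}) ∪
    {x ∈ C | ∑ i, x i = 1 ∧ 0 < d} with hH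
  have hsub : s.toSet d \ interior (s.toSet d) ⊆ H := by
    rintro x ⟨hx, hxi⟩
    have hxC : x ∈ C := s.toSet_subset_cube hx
    have hns : x ∉ s.strictSet d := fun h => hxi (s.strictSet_subset_interior h)
    cases s with
    | cube =>
      have : ∃ i, ¬ (0 < x i ∧ x i < 1) := by
        by_contra! h
        exact hns fun i => h i
      obtain ⟨i, hi⟩ := this
      refine Or.inl (mem_iUnion.2 ⟨i, ?_⟩)
      by_cases h0 : x i = 0
      · exact Or.inl ⟨hxC, h0⟩
      · refine Or.inr ⟨hxC, ?_⟩
        have h1 := hx i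
        by_contra h2
        exact hi ⟨lt_of_le_of_ne h1.1 (Ne.symm h0), lt_of_le_of_ne h1.2 h2⟩
    | simplex =>
      by_cases h : ∃ i, x i = 0
      · obtain ⟨i, hi⟩ := h
        exact Or.inl (mem_iUnion.2 ⟨i, Or.inl ⟨hxC, hi⟩⟩)
      · push Not at h
        have h1 : ∑ i, x i = 1 := by
          by_contra h2
          exact hns ⟨fun i => lt_of_le_of_ne (hx.1 i) (Ne.symm (h i)), lt_of_le_of_ne hx.2 h2⟩
        refine Or.inr ⟨hxC, h1, ?_⟩
        rcases Nat.eq_zero_or_pos d with rfl | hd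
        · simp at h1
        · exact hd
  have hcoord : ∀ (i : Fin d) (c : ℝ), surf d {x ∈ C | x i = c} < ⊤ := by
    intro i c
    refine surf_lt_top_of_subset_hyperplane (hb _) (a := EuclideanSpace.single i 1) (c := c) ?_ ?_
    · simp
    · rintro x ⟨-, hx⟩
      simpa [EuclideanSpace.inner_single_left] using hx
  have hsum : surf d {x ∈ C | ∑ i, x i = 1 ∧ 0 < d} < ⊤ := by
    rcases Nat.eq_zero_or_pos d with rfl | hd
    · simp
    refine surf_lt_top_of_subset_hyperplane (hb _) (a := WithLp.toLp 2 fun _ => 1) (c := 1) ?_ ?_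
    · intro h
      simpa using congrFun (congrArg WithLp.ofLp h) ⟨0, hd⟩
    · rintro x ⟨-, hx, -⟩
      simpa [PiLp.inner_apply] using hx
  refine (measure_mono hsub).trans_lt ((measure_union_le _ _).trans_lt ?_)
  refine ENNReal.add_lt_top.2 ⟨(measure_iUnion_fintype_le _ _).trans_lt ?_, hsum⟩
  exact ENNReal.sum_lt_top.2 fun i _ => (measure_union_le _ _).trans_lt
    (ENNReal.add_lt_top.2 ⟨hcoord i 0, hcoord i 1⟩)

end RefShape


/-! ### Matrices of linear maps -/

section MatrixOf

variable {d : ℕ}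

/-- The matrix of a linear map in the standard basis. -/
noncomputable def matOf : (E d →L[ℝ] E d) →ₗ[ℝ] Matrix (Fin d) (Fin d) ℝ where
  toFun L := Matrix.of fun i j => L (EuclideanSpace.single j 1) i
  map_add' _ _ := rfl
  map_smul' _ _ := rfl

theorem matOf_apply (L : E d →L[ℝ] E d) (i j : Fin d) :
    matOf L i j = L (EuclideanSpace.single j 1) i := rfl

theorem matOf_eq_toMatrix (L : E d →L[ℝ] E d) :
    matOf L = LinearMap.toMatrix (EuclideanSpace.basisFun (Fin d) ℝ).toBasis
      (EuclideanSpace.basisFun (Fin d) ℝ).toBasis L.toLinearMap := by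
  ext i j
  simp [LinearMap.toMatrix_apply, matOf_apply]

theorem matOf_comp (L L' : E d →L[ℝ] E d) : matOf (L.comp L') = matOf L * matOf L' := by
  simp only [matOf_eq_toMatrix]
  exact LinearMap.toMatrix_comp _ _ _ _ _

theorem det_matOf (L : E d →L[ℝ] E d) : (matOf L).det = L.det := by
  rw [matOf_eq_toMatrix, LinearMap.det_toMatrix]

theorem matOf_injective : Function.Injective (matOf (d := d)) := by
  intro L L' h
  rw [matOf_eq_toMatrix, matOf_eq_toMatrix] at h
  exact ContinuousLinearMap.coe_injective (LinearMap.toMatrix _ _ |>.injective h)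

theorem abs_matOf_le (L : E d →L[ℝ] E d) (i j : Fin d) : |matOf L i j| ≤ ‖L‖ := by
  have h1 := PiLp.norm_apply_le (L (EuclideanSpace.single j (1 : ℝ))) i
  have h2 := L.le_opNorm (EuclideanSpace.single j (1 : ℝ))
  rw [PiLp.norm_single, norm_one, mul_one] at h2
  exact h1.trans h2

theorem abs_det_le_of_norm_le {L : E d →L[ℝ] E d} {b : ℝ} (hL : ‖L‖ ≤ b) :
    |L.det| ≤ d.factorial * b ^ d := by
  have h := Matrix.det_le (A := matOf L) (abv := AbsoluteValue.abs) (x := b)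
    fun i j => (abs_matOf_le L i j).trans hL
  rw [det_matOf] at h
  simpa using h

end MatrixOf

/-! ### Polynomial maps -/

section PolyMap

open MvPolynomial

variable {d : ℕ}

theorem totalDegree_pderiv_le (j : Fin d) (p : MvPolynomial (Fin d) ℝ) :
    (pderiv j p).totalDegree ≤ p.totalDegree := by
  conv_lhs => rw [p.as_sum, map_sum]
  refine totalDegree_finsetSum_le fun s hs => ?_
  rw [pderiv_monomial]
  refine (totalDegree_monomial_le _ _).trans ?_
  refine le_trans ?_ (le_totalDegree hs)
  refine Finsupp.sum_le_sum_index (f₁ := s - Finsupp.single j 1) (f₂ := s) (fun i => ?_)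
    (fun _ _ => monotone_id) fun _ _ => rfl
  simp

/-- Strict differentiability is what the inverse function theorem for cell maps requires. -/
theorem hasStrictFDerivAt_polyEval (p : MvPolynomial (Fin d) ℝ) (x : E d) :
    HasStrictFDerivAt (fun y : E d => eval (fun j => y j) p)
      (∑ j, eval (fun i => x i) (pderiv j p) • (EuclideanSpace.proj j : E d →L[ℝ] ℝ)) x := by
  induction p using MvPolynomial.induction_on with
  | C a => simpa using hasStrictFDerivAt_const a x
  | add p q hp hq =>
    have := hp.add hq
    simp only [map_add, add_smul, Finset.sum_add_distrib]
    exact this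
  | mul_X p i hp =>
    have hX : HasStrictFDerivAt (fun y : E d => y i) (EuclideanSpace.proj i : E d →L[ℝ] ℝ) x :=
      (EuclideanSpace.proj i : E d →L[ℝ] ℝ).hasStrictFDerivAt
    have := hp.mul hX
    simp only [map_mul, eval_X]
    refine this.congr_fderiv ?_
    ext v
    simp only [pderiv_mul, pderiv_X, map_add, map_mul, eval_X, Pi.single_apply, apply_ite (eval _),
      map_zero, add_apply, smul_apply,
      sum_apply, PiLp.proj_apply, smul_eq_mul, add_mul, mul_ite, ite_mul,
      mul_one, mul_zero, zero_mul, Finset.sum_add_distrib, Finset.sum_ite_eq,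
      Finset.mem_univ, if_true, Finset.mul_sum]
    rw [add_comm]
    exact congrArg₂ _ (Finset.sum_congr rfl fun j _ => by ring) rfl

/-- The vector field with components `P i`. -/
noncomputable def polyMap (P : Fin d → MvPolynomial (Fin d) ℝ) (x : E d) : E d :=
  WithLp.toLp 2 fun i => eval (fun j => x j) (P i)

/-- The Jacobian matrix of a polynomial vector field, as a matrix of polynomials. -/
noncomputable def polyJac (P : Fin d → MvPolynomial (Fin d) ℝ) :
    Matrix (Fin d) (Fin d) (MvPolynomial (Fin d) ℝ) :=
  Matrix.of fun i j => pderiv j (P i)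

theorem exists_hasStrictFDerivAt_polyMap (P : Fin d → MvPolynomial (Fin d) ℝ) (x : E d) :
    ∃ L : E d →L[ℝ] E d, HasStrictFDerivAt (polyMap P) L x ∧
      matOf L = (eval fun j => x j).mapMatrix (polyJac P) := by
  have h1 : HasStrictFDerivAt (fun y : E d => fun i => eval (fun j => y j) (P i))
      (ContinuousLinearMap.pi fun i => ∑ j, eval (fun i => x i) (pderiv j (P i)) •
        (EuclideanSpace.proj j : E d →L[ℝ] ℝ)) x :=
    hasStrictFDerivAt_pi.2 fun i => hasStrictFDerivAt_polyEval (P i) x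
  have h2 := ((EuclideanSpace.equiv (Fin d) ℝ).symm.hasStrictFDerivAt).comp x h1
  refine ⟨_, h2, ?_⟩
  ext i j
  simp [matOf_apply, polyJac]

theorem matOf_fderiv_polyMap (P : Fin d → MvPolynomial (Fin d) ℝ) (x : E d) :
    matOf (fderiv ℝ (polyMap P) x) = (eval fun j => x j).mapMatrix (polyJac P) := by
  obtain ⟨L, h, hL⟩ := exists_hasStrictFDerivAt_polyMap P x
  rw [h.hasFDerivAt.fderiv, hL]

theorem hasStrictFDerivAt_polyMap (P : Fin d → MvPolynomial (Fin d) ℝ) (x : E d) :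
    HasStrictFDerivAt (polyMap P) (fderiv ℝ (polyMap P) x) x := by
  obtain ⟨L, h, -⟩ := exists_hasStrictFDerivAt_polyMap P x
  rwa [h.hasFDerivAt.fderiv]

theorem continuous_polyMap (P : Fin d → MvPolynomial (Fin d) ℝ) : Continuous (polyMap P) :=
  continuous_iff_continuousAt.2 fun x => (hasStrictFDerivAt_polyMap P x).continuousAt

/-- The matrix entries are polynomials, and a linear left inverse of `matOf` recovers the derivative
from its matrix. -/
theorem continuous_fderiv_polyMap (P : Fin d → MvPolynomial (Fin d) ℝ) :
    Continuous (fderiv ℝ (polyMap P)) := by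
  have h : Continuous fun x => matOf (fderiv ℝ (polyMap P) x) := by
    simp only [matOf_fderiv_polyMap]
    exact continuous_pi fun i => continuous_pi fun j => continuous_polyEval (polyJac P i j)
  obtain ⟨L, hL⟩ := (matOf (d := d)).exists_leftInverse_of_injective
    (LinearMap.ker_eq_bot.2 matOf_injective)
  have h2 := (LinearMap.continuous_of_finiteDimensional L).comp h
  refine h2.congr fun x => ?_
  exact LinearMap.congr_fun hL _

theorem totalDegree_det_le {A : Matrix (Fin d) (Fin d) (MvPolynomial (Fin d) ℝ)} {m : ℕ}
    (h : ∀ i j, (A i j).totalDegree ≤ m) : A.det.totalDegree ≤ d * m := by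
  rw [Matrix.det_apply]
  refine totalDegree_finsetSum_le fun σ _ => ?_
  have h1 : (∏ i, A (σ i) i).totalDegree ≤ d * m := by
    refine (totalDegree_finsetProd _ _).trans ?_
    refine (Finset.sum_le_sum fun i _ => h (σ i) i).trans ?_
    simp
  rcases Int.units_eq_one_or (Equiv.Perm.sign σ) with hs | hs <;> rw [hs]
  · simpa using h1
  · simpa using h1

/-- An adjugate entry is the determinant of `A` with one row replaced by a unit vector, so the
determinant bound applies. -/
theorem totalDegree_adjugate_le {A : Matrix (Fin d) (Fin d) (MvPolynomial (Fin d) ℝ)} {m : ℕ}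
    (h : ∀ i j, (A i j).totalDegree ≤ m) (i j : Fin d) :
    (A.adjugate i j).totalDegree ≤ d * m := by
  rw [Matrix.adjugate_apply]
  refine totalDegree_det_le fun a b => ?_
  by_cases hj : a = j
  · subst hj
    rw [Matrix.updateRow_self, Pi.single_apply]
    split_ifs <;> simp
  · rw [Matrix.updateRow_ne hj]
    exact h a b

end PolyMap


/-! ### Geometry of Lipschitz domains and meshes -/

/-- Lipschitz domains have no slits: moving from a boundary point against the graph direction `e`
leaves `φ` unchanged and lowers the height, so it leaves the closure. This later places open cells
inside `Ω`. -/
theorem IsLipschitzDomain.interior_closure {d : ℕ} {Ω : Set (E d)} (h : IsLipschitzDomain Ω) :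
    interior (closure Ω) = Ω := by
  refine Subset.antisymm (fun x hx => ?_) (interior_maximal subset_closure h.isOpen)
  by_contra hxΩ
  have hxc : x ∈ closure Ω := interior_subset hx
  obtain ⟨r, hr, e, he, L, φ, hφ, hφe, hloc⟩ := h.local_graph x
    ⟨hxc, fun hi => hxΩ (h.isOpen.interior_eq ▸ hi)⟩
  have hball : Metric.ball x r ∈ 𝓝 x := Metric.ball_mem_nhds x hr
  have hcl : ∀ y ∈ closure Ω, y ∈ Metric.ball x r → φ y ≤ inner ℝ y e := by
    intro y hy hyr
    have hcl : IsClosed {z | φ z ≤ inner ℝ z e} :=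
      isClosed_le hφ.continuous (by fun_prop)
    have h1 : y ∈ closure (Metric.ball x r ∩ Ω) :=
      Metric.isOpen_ball.inter_closure ⟨hyr, hy⟩
    exact hcl.closure_subset_iff.2 (fun z hz => ((hloc z hz.1).1 hz.2).le) h1
  have hge : inner ℝ x e ≤ φ x := by
    by_contra! hlt
    exact hxΩ ((hloc x (Metric.mem_ball_self hr)).2 hlt)
  have hcont : Tendsto (fun t : ℝ => x + t • e) (𝓝[<] 0) (𝓝 x) := by
    have : ContinuousAt (fun t : ℝ => x + t • e) 0 := by fun_prop
    have h2 := this.tendsto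
    simp only [zero_smul, add_zero] at h2
    exact h2.mono_left nhdsWithin_le_nhds
  obtain ⟨t, ⟨ht1, ht2⟩, ht⟩ := (((hcont.eventually (isOpen_interior.mem_nhds hx)).and
    (hcont.eventually hball)).and self_mem_nhdsWithin).exists
  have h3 := hcl _ (interior_subset ht1) ht2
  rw [hφe, inner_add_left, real_inner_smul_left, real_inner_self_eq_norm_sq, he] at h3
  have : t < 0 := ht
  linarith

namespace Mesh

variable {d : ℕ} (M : Mesh d)

/-- The image of the open reference cell. -/
def openCell (c : M.Cell) : Set (E d) := M.map c '' interior (M.ref c)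

theorem openCell_subset_cell (c : M.Cell) : M.openCell c ⊆ M.cell c :=
  image_mono interior_subset

namespace IsShapeRegular

variable {M} {Ω : Set (E d)} {m : ℕ} {κ : ℝ} (hM : M.IsShapeRegular Ω m κ)

include hM

theorem exists_poly (c : M.Cell) : ∃ P : Fin d → MvPolynomial (Fin d) ℝ,
    (∀ i, (P i).totalDegree ≤ m) ∧ M.map c = polyMap P := by
  obtain ⟨P, hP, h⟩ := hM.map_poly c
  refine ⟨P, hP, funext fun x => ?_⟩
  ext i
  exact h x (mem_univ x) i

theorem hasStrictFDerivAt (c : M.Cell) (x : E d) :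
    HasStrictFDerivAt (M.map c) (fderiv ℝ (M.map c) x) x := by
  obtain ⟨P, -, h⟩ := hM.exists_poly c
  rw [h]
  exact hasStrictFDerivAt_polyMap P x

theorem differentiable (c : M.Cell) : Differentiable ℝ (M.map c) :=
  fun x => (hM.hasStrictFDerivAt c x).differentiableAt

theorem isCompact_cell (c : M.Cell) : IsCompact (M.cell c) :=
  (M.shape c).isCompact_toSet.image (hM.differentiable c).continuous

theorem cell_subset (c : M.Cell) : M.cell c ⊆ closure Ω :=
  hM.cover ▸ subset_iUnion M.cell c

theorem diam_pos (hd : 0 < d) (c : M.Cell) : 0 < M.diam c := by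
  have : Nontrivial (E d) := by
    have : Nonempty (Fin d) := ⟨⟨0, hd⟩⟩
    infer_instance
  refine Metric.diam_pos ?_ (hM.isCompact_cell c).isBounded
  have hnt : (M.ref c).Nontrivial := by
    by_contra hs
    rw [not_nontrivial_iff] at hs
    obtain ⟨x, hx⟩ := (M.shape c).interior_nonempty (d := d)
    have h1 : interior ((M.shape c).toSet d) = {x} :=
      (hs.anti interior_subset).eq_singleton_of_mem hx
    exact not_isOpen_singleton x (h1 ▸ isOpen_interior)
  exact hnt.image_of_injOn (hM.map_inj c)

/-- The lower derivative bound on a unit vector forces this as soon as there is a cell. -/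
theorem kappa_pos (hd : 0 < d) (c : M.Cell) : 0 < κ := by
  obtain ⟨x, hx⟩ := (M.shape c).interior_nonempty (d := d)
  have h := hM.le_deriv c x (interior_subset hx) (EuclideanSpace.single ⟨0, hd⟩ 1)
  rw [PiLp.norm_single, norm_one, mul_one] at h
  by_contra hκ
  have := hM.diam_pos hd c
  nlinarith [norm_nonneg (fderiv ℝ (M.map c) x (EuclideanSpace.single ⟨0, hd⟩ 1))]

/-- The lower derivative bound gives injectivity, hence invertibility in finite dimension, together
with the norm of the inverse. -/
theorem exists_equiv (hd : 0 < d) (c : M.Cell) {x : E d} (hx : x ∈ M.ref c) :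
    ∃ e : E d ≃L[ℝ] E d, (e : E d →L[ℝ] E d) = fderiv ℝ (M.map c) x ∧
      ‖(e.symm : E d →L[ℝ] E d)‖ ≤ κ / M.diam c := by
  have hh := hM.diam_pos hd c
  have hκ := hM.kappa_pos hd c
  have hle := hM.le_deriv c x hx
  have hinj : Function.Injective (fderiv ℝ (M.map c) x).toLinearMap := by
    rw [injective_iff_map_eq_zero]
    intro w hw
    have h1 := hle w
    rw [show fderiv ℝ (M.map c) x w = 0 from hw, norm_zero, mul_zero] at h1
    have h2 : ‖w‖ ≤ 0 := by
      by_contra! h3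
      nlinarith [mul_pos hh h3]
    exact norm_le_zero_iff.1 h2
  let e := (LinearEquiv.ofInjectiveEndo _ hinj).toContinuousLinearEquiv
  have he : ∀ w, e w = fderiv ℝ (M.map c) x w := fun w => rfl
  refine ⟨e, by ext1 w; exact he w, ?_⟩
  refine ContinuousLinearMap.opNorm_le_bound _ (by positivity) fun w => ?_
  have h1 := hle (e.symm w)
  rw [← he, e.apply_symm_apply] at h1
  rw [div_mul_eq_mul_div, le_div_iff₀ hh]
  change ‖e.symm w‖ * _ ≤ _
  linarith

theorem abs_det_le (c : M.Cell) {x : E d} (hx : x ∈ M.ref c) :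
    |(fderiv ℝ (M.map c) x).det| ≤ d.factorial * κ ^ d * M.diam c ^ d := by
  rw [mul_assoc, ← mul_pow]
  exact abs_det_le_of_norm_le (hM.deriv_le c x hx)

/-- The upper determinant bound is applied to the inverse derivative, and the two determinants
multiply to one. -/
theorem le_abs_det (hd : 0 < d) (c : M.Cell) {x : E d} (hx : x ∈ M.ref c) :
    M.diam c ^ d ≤ d.factorial * κ ^ d * |(fderiv ℝ (M.map c) x).det| := by
  obtain ⟨e, he, hn⟩ := hM.exists_equiv hd c hx
  have h1 := abs_det_le_of_norm_le hn
  have h2 : |(e.symm : E d →L[ℝ] E d).det| * |(fderiv ℝ (M.map c) x).det| = 1 := by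
    rw [← abs_mul, ← det_matOf, ← det_matOf, ← Matrix.det_mul, ← matOf_comp, ← he,
      e.coe_symm_comp_coe, det_matOf, ContinuousLinearMap.det]
    simp
  have hh := hM.diam_pos hd c
  rw [div_pow, ← mul_div_assoc, le_div_iff₀ (by positivity)] at h1
  have h3 := mul_le_mul_of_nonneg_right h1 (abs_nonneg (fderiv ℝ (M.map c) x).det)
  rw [mul_right_comm, h2, one_mul] at h3
  exact h3

theorem map_nhds (hd : 0 < d) (c : M.Cell) {x : E d} (hx : x ∈ M.ref c) :
    Filter.map (M.map c) (𝓝 x) = 𝓝 (M.map c x) := by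
  obtain ⟨e, he, -⟩ := hM.exists_equiv hd c hx
  have h := hM.hasStrictFDerivAt c x
  rw [← he] at h
  exact h.map_nhds_eq_of_equiv

theorem isOpen_openCell (hd : 0 < d) (c : M.Cell) : IsOpen (M.openCell c) := by
  rw [isOpen_iff_mem_nhds]
  rintro _ ⟨x, hx, rfl⟩
  rw [← hM.map_nhds hd c (interior_subset hx)]
  exact image_mem_map (isOpen_interior.mem_nhds hx)

theorem openCell_subset_interior (hd : 0 < d) (c : M.Cell) :
    M.openCell c ⊆ interior (M.cell c) :=
  interior_maximal (M.openCell_subset_cell c) (hM.isOpen_openCell hd c)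

theorem openCell_subset (hd : 0 < d) (hΩ : IsLipschitzDomain Ω) (c : M.Cell) :
    M.openCell c ⊆ Ω := by
  rw [← hΩ.interior_closure]
  exact interior_maximal ((M.openCell_subset_cell c).trans (hM.cell_subset c))
    (hM.isOpen_openCell hd c)

theorem pairwise_disjoint_openCell (hd : 0 < d) :
    Pairwise (Function.onFun Disjoint M.openCell) := fun c c' h =>
  (hM.disjoint h).mono (hM.openCell_subset_interior hd c) (hM.openCell_subset_interior hd c')

theorem cell_subset_closure_openCell (c : M.Cell) : M.cell c ⊆ closure (M.openCell c) := by
  refine Subset.trans (image_mono (M.shape c).subset_closure_interior) ?_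
  exact image_closure_subset_closure_image (hM.differentiable c).continuous

theorem isPreconnected_openCell (c : M.Cell) : IsPreconnected (M.openCell c) :=
  ((M.shape c).convex_toSet.interior.isPreconnected).image _
    (hM.differentiable c).continuous.continuousOn

/-- Boundaries of convex reference cells are null and differentiable maps preserve null sets, so the
mesh skeleton is negligible. -/
theorem mem_iUnion_openCell_ae : ∀ᵐ x ∂(volume.restrict Ω), x ∈ ⋃ c, M.openCell c := by
  have : Countable M.Cell := by have := M.finite; infer_instance
  have h0 : volume (⋃ c, M.map c '' (M.ref c \ interior (M.ref c))) = 0 := by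
    refine measure_iUnion_null fun c => ?_
    exact addHaar_image_eq_zero_of_differentiableOn_of_addHaar_eq_zero volume
      (hM.differentiable c).differentiableOn (M.shape c).volume_diff_interior
  have h1 : ∀ᵐ x ∂(volume.restrict Ω), x ∈ closure Ω := by
    have h := ae_restrict_mem (μ := volume) (isClosed_closure (s := Ω)).measurableSet
    exact ae_mono (Measure.restrict_mono subset_closure le_rfl) h
  filter_upwards [h1, ae_restrict_of_ae (measure_eq_zero_iff_ae_notMem.1 h0)] with x hx hx'
  rw [← hM.cover] at hx
  obtain ⟨c, y, hy, rfl⟩ := mem_iUnion.1 hx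
  refine mem_iUnion.2 ⟨c, y, ?_, rfl⟩
  by_contra hyi
  exact hx' (mem_iUnion.2 ⟨c, y, ⟨hy, hyi⟩, rfl⟩)

theorem lipschitzOnWith (c : M.Cell) :
    LipschitzOnWith (κ * M.diam c).toNNReal (M.map c) (M.ref c) := by
  refine (M.shape c).convex_toSet.lipschitzOnWith_of_nnnorm_fderiv_le
    (fun x _ => hM.differentiable c x) fun x hx => ?_
  rw [← NNReal.coe_le_coe, coe_nnnorm]
  exact (hM.deriv_le c x hx).trans (Real.le_coe_toNNReal _)

/-- The surface measure of the part of the boundary that lies in a cell. -/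
theorem surf_frontier_inter_cell_le (hd : 0 < d) (hΩ : IsLipschitzDomain Ω) (c : M.Cell) :
    surf d (frontier Ω ∩ M.cell c) ≤ ENNReal.ofReal ((κ * M.diam c) ^ (d - 1)) *
      surf d (M.ref c \ interior (M.ref c)) := by
  -- An interior reference point is mapped into `Ω`, which is open and so misses its frontier.
  have hsub : frontier Ω ∩ M.cell c ⊆ M.map c '' (M.ref c \ interior (M.ref c)) := by
    rintro _ ⟨hy, x, hx, rfl⟩
    refine ⟨x, ⟨hx, fun hxi => hy.2 ?_⟩, rfl⟩
    rw [hΩ.isOpen.interior_eq]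
    exact hM.openCell_subset hd hΩ c ⟨x, hxi, rfl⟩
  refine (measure_mono hsub).trans ((surf_image_le ((hM.lipschitzOnWith c).mono
    sdiff_subset)).trans_eq ?_)
  have := hM.diam_pos hd c
  have := hM.kappa_pos hd c
  rw [ENNReal.ofReal_pow (by positivity)]
  rfl

theorem surf_frontier_lt_top (hd : 0 < d) (hΩ : IsLipschitzDomain Ω) :
    surf d (frontier Ω) < ⊤ := by
  have := M.finite
  have := Fintype.ofFinite M.Cell
  have hsub : frontier Ω ⊆ ⋃ c, frontier Ω ∩ M.cell c := by
    rw [← inter_iUnion, hM.cover]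
    exact fun x hx => ⟨hx, frontier_subset_closure hx⟩
  refine (measure_mono hsub).trans_lt ((measure_iUnion_fintype_le _ _).trans_lt ?_)
  refine ENNReal.sum_lt_top.2 fun c _ => (hM.surf_frontier_inter_cell_le hd hΩ c).trans_lt ?_
  exact ENNReal.mul_lt_top ENNReal.ofReal_lt_top (M.shape c).surf_diff_interior_lt_top

end IsShapeRegular

end Mesh


/-! ### Finite element functions -/

theorem continuous_matVec {d : ℕ} : Continuous (matVec (d := d)) :=
  (PiLp.continuous_toLp 2 _).comp (continuous_pi fun q => continuous_id.matrix_elem q.1 q.2)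

namespace Mesh

variable {d : ℕ} {M : Mesh d} {Ω : Set (E d)} {k m : ℕ} {κ : ℝ} {v : E d → E d}

theorem IsFEFunction.exists_poly (hv : M.IsFEFunction k v) (c : M.Cell) :
    ∃ P : Fin d → MvPolynomial (Fin d) ℝ, (∀ i, (P i).totalDegree ≤ k) ∧
      ∀ x ∈ M.ref c, v (M.map c x) = polyMap P x := by
  obtain ⟨P, hP, h⟩ := hv c
  refine ⟨P, hP, fun x hx => ?_⟩
  ext i
  exact h x hx i

namespace IsShapeRegular

variable (hM : M.IsShapeRegular Ω m κ)

include hM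

/-- Finitely many closed cells cover, so continuity on each suffices. There the preimage of a closed
set is the image of a compact set of reference points, and no continuous inverse of the cell map is
needed. -/
theorem continuousOn_of_isFEFunction (hv : M.IsFEFunction k v) : ContinuousOn v (closure Ω) := by
  have := M.finite
  rw [← hM.cover]
  refine (locallyFinite_of_finite _).continuousOn_iUnion
    (fun c => (hM.isCompact_cell c).isClosed) fun c => ?_
  obtain ⟨P, -, hP⟩ := hv.exists_poly c
  rw [continuousOn_iff_isClosed]
  intro t ht
  have hK : IsCompact (M.ref c ∩ polyMap P ⁻¹' t) :=
    (M.shape c).isCompact_toSet.inter_right (ht.preimage (continuous_polyMap P))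
  refine ⟨M.map c '' (M.ref c ∩ polyMap P ⁻¹' t),
    (hK.image (hM.differentiable c).continuous).isClosed, ?_⟩
  ext y
  constructor
  · rintro ⟨hy, x, hx, rfl⟩
    refine ⟨⟨x, ⟨hx, ?_⟩, rfl⟩, x, hx, rfl⟩
    rw [mem_preimage, ← hP x hx]
    exact hy
  · rintro ⟨⟨x, ⟨hx, hxt⟩, rfl⟩, hy⟩
    refine ⟨?_, hy⟩
    rw [mem_preimage, hP x hx]
    exact hxt

theorem differentiableAt_of_mem_openCell (hd : 0 < d) (hv : M.IsFEFunction k v) {c : M.Cell}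
    {y : E d} (hy : y ∈ M.openCell c) : DifferentiableAt ℝ v y := by
  obtain ⟨x, hx, rfl⟩ := hy
  obtain ⟨P, -, hP⟩ := hv.exists_poly c
  obtain ⟨e, he, -⟩ := hM.exists_equiv hd c (interior_subset hx)
  have h := hM.hasStrictFDerivAt c x
  rw [← he] at h
  have hg := h.to_localInverse.hasFDerivAt.differentiableAt
  have h1 : DifferentiableAt ℝ (polyMap P ∘ h.localInverse (M.map c) e x) (M.map c x) :=
    DifferentiableAt.comp _ (hasStrictFDerivAt_polyMap P _).differentiableAt hg
  refine h1.congr_of_eventuallyEq ?_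
  filter_upwards [h.eventually_right_inverse,
    h.localInverse_tendsto.eventually (isOpen_interior.mem_nhds hx)] with z hz1 hz2
  rw [Function.comp_apply, ← hP _ (interior_subset hz2), hz1]

theorem closure_mem_nhds_of_mem_openCell (hd : 0 < d) {c : M.Cell} {y : E d}
    (hy : y ∈ M.openCell c) : closure Ω ∈ 𝓝 y :=
  mem_of_superset ((hM.isOpen_openCell hd c).mem_nhds hy)
    ((M.openCell_subset_cell c).trans (hM.cell_subset c))

/-- The chain rule for the pullback of a finite element function to the reference cell. -/
theorem fderivWithin_comp_fderiv {c : M.Cell} {P : Fin d → MvPolynomial (Fin d) ℝ}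
    (hP : ∀ x ∈ M.ref c, v (M.map c x) = polyMap P x) {x : E d} (hx : x ∈ M.ref c)
    (hdiff : DifferentiableWithinAt ℝ v (closure Ω) (M.map c x)) :
    (fderivWithin ℝ v (closure Ω) (M.map c x)).comp (fderiv ℝ (M.map c) x)
      = fderiv ℝ (polyMap P) x := by
  have hmaps : MapsTo (M.map c) (M.ref c) (closure Ω) := fun z hz =>
    hM.cell_subset c ⟨z, hz, rfl⟩
  have h1 := hdiff.hasFDerivWithinAt.comp x
    (hM.differentiable c x).hasFDerivAt.hasFDerivWithinAt hmaps
  have h2 : HasFDerivWithinAt (v ∘ M.map c) (fderiv ℝ (polyMap P) x) (M.ref c) x :=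
    (hasStrictFDerivAt_polyMap P x).hasFDerivAt.hasFDerivWithinAt.congr hP (hP x hx)
  -- The reference cell is convex with interior, so derivatives within it are unique even at its
  -- boundary points.
  exact ((M.shape c).uniqueDiffOn x hx).eq h1 h2

/-- Where the derivative within the closure exists, the chain rule and the inverse bound control it;
elsewhere it has the default value zero. The bound therefore holds at every point, including the
skeleton and the boundary. -/
theorem exists_norm_fderivWithin_le (hd : 0 < d) (hv : M.IsFEFunction k v) :
    ∃ B : ℝ, 0 ≤ B ∧ ∀ y ∈ closure Ω, ‖fderivWithin ℝ v (closure Ω) y‖ ≤ B := by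
  have := M.finite
  have := Fintype.ofFinite M.Cell
  have hc : ∀ c, ∃ B : ℝ, 0 ≤ B ∧ ∀ y ∈ M.cell c, ‖fderivWithin ℝ v (closure Ω) y‖ ≤ B := by
    intro c
    obtain ⟨P, -, hP⟩ := hv.exists_poly c
    obtain ⟨b, hb⟩ := (M.shape c).isCompact_toSet.exists_bound_of_continuousOn
      (continuous_fderiv_polyMap P).continuousOn
    have hκ := hM.kappa_pos hd c
    have hh := hM.diam_pos hd c
    refine ⟨|b| * (κ / M.diam c), by positivity, ?_⟩
    rintro _ ⟨x, hx, rfl⟩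
    by_cases hdiff : DifferentiableWithinAt ℝ v (closure Ω) (M.map c x)
    · obtain ⟨e, he, hn⟩ := hM.exists_equiv hd c hx
      have h1 := hM.fderivWithin_comp_fderiv hP hx hdiff
      have h2 : fderivWithin ℝ v (closure Ω) (M.map c x)
          = (fderiv ℝ (polyMap P) x).comp (e.symm : E d →L[ℝ] E d) := by
        rw [← h1, ← he, ContinuousLinearMap.comp_assoc, e.coe_comp_coe_symm,
          ContinuousLinearMap.comp_id]
      rw [h2]
      refine (ContinuousLinearMap.opNorm_comp_le _ _).trans ?_
      exact mul_le_mul ((hb x hx).trans (le_abs_self b)) hn (norm_nonneg _) (abs_nonneg b)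
    · rw [fderivWithin_zero_of_not_differentiableWithinAt hdiff, norm_zero]
      positivity
  choose B hB0 hB using hc
  refine ⟨∑ c, B c, Finset.sum_nonneg fun c _ => hB0 c, fun y hy => ?_⟩
  rw [← hM.cover] at hy
  obtain ⟨c, hc⟩ := mem_iUnion.1 hy
  exact (hB c y hc).trans (Finset.single_le_sum (fun c _ => hB0 c) (Finset.mem_univ c))

/-- The unrestricted derivative of any map is measurable, and it agrees with the one within the
closure on open cells. -/
theorem aestronglyMeasurable_jac_apply (hd : 0 < d) (i j : Fin d) :
    AEStronglyMeasurable (fun x => jac Ω v x i j) (volume.restrict Ω) := by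
  have h : Measurable fun x => fderiv ℝ v x (EuclideanSpace.single j 1) i :=
    (EuclideanSpace.proj i : E d →L[ℝ] ℝ).continuous.measurable.comp
      (measurable_fderiv_apply_const ℝ v _)
  refine h.aestronglyMeasurable.congr ?_
  filter_upwards [hM.mem_iUnion_openCell_ae] with x hx
  obtain ⟨c, hc⟩ := mem_iUnion.1 hx
  simp only [jac, Matrix.of_apply]
  rw [fderivWithin_of_mem_nhds (hM.closure_mem_nhds_of_mem_openCell hd hc)]

theorem aestronglyMeasurable_jac (hd : 0 < d) :
    AEStronglyMeasurable (jac Ω v) (volume.restrict Ω) := by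
  have hof : Continuous fun q : Fin d → Fin d → ℝ => Matrix.of q := continuous_id
  have h : AEMeasurable (fun x => fun i j => jac Ω v x i j) (volume.restrict Ω) :=
    aemeasurable_pi_lambda _ fun i => aemeasurable_pi_lambda _ fun j =>
      (hM.aestronglyMeasurable_jac_apply hd i j).aemeasurable
  exact hof.comp_aestronglyMeasurable h.aestronglyMeasurable

theorem aestronglyMeasurable_symGrad (hd : 0 < d) :
    AEStronglyMeasurable (symGrad Ω v) (volume.restrict Ω) :=
  continuous_symPart.comp_aestronglyMeasurable (hM.aestronglyMeasurable_jac hd)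

theorem exists_norm_matVec_jac_le (hd : 0 < d) (hv : M.IsFEFunction k v) :
    ∃ B : ℝ, 0 ≤ B ∧ ∀ y ∈ closure Ω, ‖matVec (jac Ω v y)‖ ≤ B := by
  obtain ⟨B, hB0, hB⟩ := hM.exists_norm_fderivWithin_le hd hv
  refine ⟨d * B, by positivity, fun y hy => ?_⟩
  rw [← sq_le_sq₀ (norm_nonneg _) (by positivity), norm_matVec_sq]
  calc ∑ i, ∑ j, jac Ω v y i j ^ 2 ≤ ∑ _i : Fin d, ∑ _j : Fin d, B ^ 2 := by
        refine Finset.sum_le_sum fun i _ => Finset.sum_le_sum fun j _ => ?_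
        rw [← sq_abs]
        refine pow_le_pow_left₀ (abs_nonneg _) ?_ 2
        exact (abs_matOf_le (fderivWithin ℝ v (closure Ω) y) i j).trans (hB y hy)
    _ = (d * B) ^ 2 := by simp; ring

theorem memLp_matVec_jac (hd : 0 < d) (hΩ : IsLipschitzDomain Ω) (hv : M.IsFEFunction k v) :
    MemLp (fun x => matVec (jac Ω v x)) 2 (volume.restrict Ω) := by
  have : IsFiniteMeasure (volume.restrict Ω) :=
    isFiniteMeasure_restrict.2 hΩ.isBounded.measure_lt_top.ne
  obtain ⟨B, -, hB⟩ := hM.exists_norm_matVec_jac_le hd hv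
  refine MemLp.of_bound (continuous_matVec.comp_aestronglyMeasurable
    (hM.aestronglyMeasurable_jac hd)) B ?_
  filter_upwards [ae_restrict_mem hΩ.isOpen.measurableSet] with x hx
  exact hB x (subset_closure hx)

end IsShapeRegular

end Mesh

theorem frobNorm_symPart_le {d : ℕ} (J : Matrix (Fin d) (Fin d) ℝ) :
    frobNorm (symPart J) ≤ ‖matVec J‖ := by
  have h1 : symVec (symPart J) = (1 / 2 : ℝ) • (matVec J + matVec J.transpose) := by
    rw [← map_add, ← map_smul]
    rfl
  have h2 : ‖matVec J.transpose‖ = ‖matVec J‖ := by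
    rw [← sq_eq_sq₀ (norm_nonneg _) (norm_nonneg _), norm_matVec_sq, norm_matVec_sq,
      Finset.sum_comm]
    rfl
  rw [frobNorm_eq_norm, h1, norm_smul]
  have h3 := norm_add_le (matVec J) (matVec J.transpose)
  rw [h2] at h3
  rw [Real.norm_of_nonneg (by norm_num)]
  linarith

/-! ### Symmetric gradients on cells and the inverse estimate -/

namespace Mesh.IsShapeRegular

variable {d : ℕ} {M : Mesh d} {Ω : Set (E d)} {k m : ℕ} {κ : ℝ} {v : E d → E d}
  (hM : M.IsShapeRegular Ω m κ)

include hM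

theorem memLp_symVec_symGrad (hd : 0 < d) (hΩ : IsLipschitzDomain Ω) (hv : M.IsFEFunction k v) :
    MemLp (fun x => symVec (symGrad Ω v x)) 2 (volume.restrict Ω) := by
  refine (hM.memLp_matVec_jac hd hΩ hv).mono ?_ ?_
  · exact (continuous_matVec.comp continuous_subtype_val).comp_aestronglyMeasurable
      (hM.aestronglyMeasurable_symGrad hd)
  · refine Eventually.of_forall fun x => ?_
    rw [← frobNorm_eq_norm]
    exact frobNorm_symPart_le _

theorem integrable_frobNorm_symGrad_sq (hd : 0 < d) (hΩ : IsLipschitzDomain Ω)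
    (hv : M.IsFEFunction k v) :
    Integrable (fun x => frobNorm (symGrad Ω v x) ^ 2) (volume.restrict Ω) := by
  have h := (hM.memLp_symVec_symGrad hd hΩ hv).integrable_norm_pow two_ne_zero
  simpa only [frobNorm_eq_norm] using h

theorem sum_openCell_le (hd : 0 < d) (hΩ : IsLipschitzDomain Ω) (hv : M.IsFEFunction k v)
    [Fintype M.Cell] :
    ∑ c, ∫ x in M.openCell c, frobNorm (symGrad Ω v x) ^ 2 ≤ symGradSq Ω v := by
  have hint := hM.integrable_frobNorm_symGrad_sq hd hΩ hv
  have hsub : (⋃ c, M.openCell c) ⊆ Ω := iUnion_subset fun c => hM.openCell_subset hd hΩ c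
  rw [← integral_iUnion_fintype (fun c => (hM.isOpen_openCell hd c).measurableSet)
    (hM.pairwise_disjoint_openCell hd)
    fun c => IntegrableOn.mono_set hint (hM.openCell_subset hd hΩ c)]
  exact setIntegral_mono_set hint (Eventually.of_forall fun x => sq_nonneg _)
    hsub.eventuallyLE

/-- On a cell, the symmetric gradient times the Jacobian determinant is a polynomial. -/
theorem exists_poly_symGrad (hv : M.IsFEFunction k v) (c : M.Cell) :
    ∃ W : Fin d → Fin d → MvPolynomial (Fin d) ℝ, (∀ i j, (W i j).totalDegree ≤ k + d * m) ∧
      ∀ x ∈ M.ref c, DifferentiableWithinAt ℝ v (closure Ω) (M.map c x) → ∀ i j,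
        (fderiv ℝ (M.map c) x).det * (symGrad Ω v (M.map c x)).1 i j
          = MvPolynomial.eval (fun j => x j) (W i j) := by
  obtain ⟨P, hPk, hP⟩ := hv.exists_poly c
  obtain ⟨Q, hQm, hQ⟩ := hM.exists_poly c
  -- The chain rule reads `∇v · DF = DP`. Multiplying by the adjugate of `DF` instead of its inverse
  -- gives `det(DF) ∇v` and stays polynomial, of degree at most `k + d m`.
  set W₀ := polyJac P * (polyJac Q).adjugate with hW₀
  have hdeg : ∀ i j, (W₀ i j).totalDegree ≤ k + d * m := by
    intro i j
    rw [hW₀, Matrix.mul_apply]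
    refine MvPolynomial.totalDegree_finsetSum_le fun l _ => ?_
    refine (MvPolynomial.totalDegree_mul _ _).trans (add_le_add ?_ ?_)
    · exact (totalDegree_pderiv_le l (P i)).trans (hPk i)
    · exact totalDegree_adjugate_le (fun a b => (totalDegree_pderiv_le b (Q a)).trans (hQm a)) _ _
  refine ⟨fun i j => MvPolynomial.C (1 / 2) * (W₀ i j + W₀ j i), fun i j => ?_, ?_⟩
  · refine (MvPolynomial.totalDegree_mul _ _).trans ?_
    rw [MvPolynomial.totalDegree_C, zero_add]
    exact (MvPolynomial.totalDegree_add _ _).trans (max_le (hdeg i j) (hdeg j i))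
  · intro x hx hdiff
    have h1 := congrArg matOf (hM.fderivWithin_comp_fderiv hP hx hdiff)
    rw [matOf_comp, matOf_fderiv_polyMap] at h1
    have h2 : (fderiv ℝ (M.map c) x).det • jac Ω v (M.map c x)
        = (MvPolynomial.eval fun j => x j).mapMatrix W₀ := by
      rw [hW₀, map_mul, ← h1, RingHom.map_adjugate, ← matOf_fderiv_polyMap, ← hQ, Matrix.mul_assoc,
        Matrix.mul_adjugate, det_matOf, Matrix.mul_smul, Matrix.mul_one]
      rfl
    have h3 : ∀ i j, (fderiv ℝ (M.map c) x).det * jac Ω v (M.map c x) i j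
        = MvPolynomial.eval (fun j => x j) (W₀ i j) := fun i j => congrFun (congrFun h2 i) j
    intro i j
    rw [map_mul, map_add, MvPolynomial.eval_C, ← h3, ← h3]
    simp only [symGrad, symPart, Matrix.smul_apply, Matrix.add_apply, Matrix.transpose_apply,
      smul_eq_mul]
    ring

end Mesh.IsShapeRegular

/-- The inverse estimate: on a cell, the symmetric gradient of a finite element function is
bounded by its mean square. -/
theorem exists_inverse_estimate (d k m : ℕ) (hd : 0 < d) (κ : ℝ) : ∃ C : ℝ, 0 < C ∧
    ∀ (M : Mesh d) (Ω : Set (E d)) (v : E d → E d), M.IsShapeRegular Ω m κ →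
      IsLipschitzDomain Ω → M.IsFEFunction k v → ∀ c, ∀ y ∈ M.cell c,
        M.diam c ^ d * frobNorm (symGrad Ω v y) ^ 2
          ≤ C * ∫ x in M.openCell c, frobNorm (symGrad Ω v x) ^ 2 := by
  have hC : ∃ C₀ : ℝ, 0 < C₀ ∧ ∀ (s : RefShape) (p : MvPolynomial (Fin d) ℝ),
      p.totalDegree ≤ k + d * m → ∀ x ∈ s.toSet d, MvPolynomial.eval (fun j => x j) p ^ 2
        ≤ C₀ * ∫ y in interior (s.toSet d), MvPolynomial.eval (fun j => y j) p ^ 2 := by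
    have h := fun s : RefShape => exists_poly_sq_le (d := d) s.isCompact_toSet
      s.subset_closure_interior (k + d * m)
    obtain ⟨C₁, h₁, h₁'⟩ := h .simplex
    obtain ⟨C₂, h₂, h₂'⟩ := h .cube
    refine ⟨C₁ + C₂, by positivity, fun s p hp x hx => ?_⟩
    have h0 : 0 ≤ ∫ y in interior (s.toSet d), MvPolynomial.eval (fun j => y j) p ^ 2 :=
      integral_nonneg fun y => sq_nonneg _
    cases s with
    | simplex => exact (h₁' p hp x hx).trans (mul_le_mul_of_nonneg_right (by linarith) h0)
    | cube => exact (h₂' p hp x hx).trans (mul_le_mul_of_nonneg_right (by linarith) h0)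
  obtain ⟨C₀, hC₀, hpoly⟩ := hC
  set N : ℝ := d.factorial * κ ^ d with hN
  -- Two powers of `N` come from the squared lower determinant bound, one from the upper bound. The
  -- absolute value and the `+ 1` secure positivity before any cell shows that `κ` is positive.
  refine ⟨C₀ * |N| ^ 3 + 1, by positivity, fun M Ω v hM hΩ hv c y hy => ?_⟩
  have hh := hM.diam_pos hd c
  have hκ := hM.kappa_pos hd c
  have hN0 : 0 ≤ N := by positivity
  set I := ∫ x in M.openCell c, frobNorm (symGrad Ω v x) ^ 2 with hI
  have hI0 : 0 ≤ I := integral_nonneg fun x => sq_nonneg _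
  obtain ⟨x, hx, rfl⟩ := hy
  by_cases hdiff : DifferentiableWithinAt ℝ v (closure Ω) (M.map c x)
  swap
  · have h0 : symGrad Ω v (M.map c x) = 0 := by
      ext i j
      simp [symGrad, symPart, jac, fderivWithin_zero_of_not_differentiableWithinAt hdiff]
    rw [h0]
    simp only [frobNorm_eq_norm, map_zero, norm_zero]
    norm_num
    positivity
  obtain ⟨W, hW, hWx⟩ := hM.exists_poly_symGrad hv c
  have hsq : ∀ z ∈ M.ref c, DifferentiableWithinAt ℝ v (closure Ω) (M.map c z) →
      (fderiv ℝ (M.map c) z).det ^ 2 * frobNorm (symGrad Ω v (M.map c z)) ^ 2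
        = ∑ i, ∑ j, MvPolynomial.eval (fun j => z j) (W i j) ^ 2 := by
    intro z hz hzd
    simp only [frobNorm_sq_eq_sum, Finset.mul_sum, ← hWx z hz hzd, mul_pow]
  have hint : ∀ i j, Integrable (fun z : E d => MvPolynomial.eval (fun j => z j) (W i j) ^ 2)
      (volume.restrict (interior (M.ref c))) := by
    intro i j
    have h1 : IntegrableOn (fun z : E d => MvPolynomial.eval (fun j => z j) (W i j) ^ 2)
        (M.ref c) := ((continuous_polyEval _).pow 2).continuousOn.integrableOn_compact
      (M.shape c).isCompact_toSet
    exact h1.mono_set interior_subset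
  have hder : ∀ z ∈ interior (M.ref c),
      HasFDerivWithinAt (M.map c) (fderiv ℝ (M.map c) z) (interior (M.ref c)) z :=
    fun z _ => (hM.differentiable c z).hasFDerivAt.hasFDerivWithinAt
  have hinj := (hM.map_inj c).mono interior_subset
  have hint2 : Integrable (fun z => |(fderiv ℝ (M.map c) z).det| •
      frobNorm (symGrad Ω v (M.map c z)) ^ 2) (volume.restrict (interior (M.ref c))) := by
    refine (integrableOn_image_iff_integrableOn_abs_det_fderiv_smul volume
      isOpen_interior.measurableSet hder hinj
      fun y => frobNorm (symGrad Ω v y) ^ 2).1 ?_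
    exact IntegrableOn.mono_set (hM.integrable_frobNorm_symGrad_sq hd hΩ hv)
      (hM.openCell_subset hd hΩ c)
  have hchange : I = ∫ z in interior (M.ref c), |(fderiv ℝ (M.map c) z).det| •
      frobNorm (symGrad Ω v (M.map c z)) ^ 2 :=
    integral_image_eq_integral_abs_det_fderiv_smul volume
      isOpen_interior.measurableSet hder hinj _
  -- Norm equivalence for the polynomial `det(DF) Dv`. In the resulting integral one factor `|det|`
  -- is the volume element and the other is at most `N h^d`.
  have h1 : (fderiv ℝ (M.map c) x).det ^ 2 * frobNorm (symGrad Ω v (M.map c x)) ^ 2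
      ≤ C₀ * (N * M.diam c ^ d * I) := by
    rw [hsq x hx hdiff]
    calc ∑ i, ∑ j, MvPolynomial.eval (fun j => x j) (W i j) ^ 2
        ≤ ∑ i, ∑ j, C₀ * ∫ z in interior (M.ref c),
            MvPolynomial.eval (fun j => z j) (W i j) ^ 2 :=
          Finset.sum_le_sum fun i _ => Finset.sum_le_sum fun j _ =>
            hpoly (M.shape c) _ (hW i j) x hx
      _ = C₀ * ∫ z in interior (M.ref c),
            ∑ i, ∑ j, MvPolynomial.eval (fun j => z j) (W i j) ^ 2 := by
          have hi : ∀ i, ∫ z in interior (M.ref c),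
              ∑ j, MvPolynomial.eval (fun j => z j) (W i j) ^ 2 = ∑ j, ∫ z in interior (M.ref c),
                MvPolynomial.eval (fun j => z j) (W i j) ^ 2 :=
            fun i => integral_finsetSum Finset.univ fun j _ => hint i j
          rw [integral_finsetSum Finset.univ fun i _ =>
            integrable_finsetSum Finset.univ fun j _ => hint i j, Finset.mul_sum]
          refine Finset.sum_congr rfl fun i _ => ?_
          rw [hi, Finset.mul_sum]
      _ ≤ C₀ * (N * M.diam c ^ d * I) := by
          refine mul_le_mul_of_nonneg_left ?_ hC₀.le
          rw [hchange, ← integral_const_mul]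
          refine integral_mono_of_nonneg (Eventually.of_forall fun z => ?_)
            (hint2.const_mul _) ?_
          · exact Finset.sum_nonneg fun i _ => Finset.sum_nonneg fun j _ => sq_nonneg _
          · filter_upwards [ae_restrict_mem isOpen_interior.measurableSet] with z hz
            have hzd := (hM.differentiableAt_of_mem_openCell hd hv
              ⟨z, hz, rfl⟩).differentiableWithinAt (s := closure Ω)
            rw [← hsq z (interior_subset hz) hzd, ← sq_abs, sq, mul_assoc, smul_eq_mul]
            exact mul_le_mul_of_nonneg_right (hM.abs_det_le c (interior_subset hz))
              (by positivity)
  have h2 := pow_le_pow_left₀ (by positivity) (hM.le_abs_det hd c hx) 2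
  rw [← hN, mul_pow, sq_abs] at h2
  have hX : 0 ≤ frobNorm (symGrad Ω v (M.map c x)) ^ 2 := sq_nonneg _
  have hH : 0 < M.diam c ^ d := by positivity
  have h3 : M.diam c ^ d * (M.diam c ^ d * frobNorm (symGrad Ω v (M.map c x)) ^ 2)
      ≤ M.diam c ^ d * (C₀ * |N| ^ 3 * I) := by
    rw [abs_of_nonneg hN0]
    calc M.diam c ^ d * (M.diam c ^ d * frobNorm (symGrad Ω v (M.map c x)) ^ 2)
        = (M.diam c ^ d) ^ 2 * frobNorm (symGrad Ω v (M.map c x)) ^ 2 := by ring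
      _ ≤ N ^ 2 * (fderiv ℝ (M.map c) x).det ^ 2 * frobNorm (symGrad Ω v (M.map c x)) ^ 2 :=
          mul_le_mul_of_nonneg_right h2 hX
      _ = N ^ 2 * ((fderiv ℝ (M.map c) x).det ^ 2 * frobNorm (symGrad Ω v (M.map c x)) ^ 2) := by
          ring
      _ ≤ N ^ 2 * (C₀ * (N * M.diam c ^ d * I)) := mul_le_mul_of_nonneg_left h1 (by positivity)
      _ = _ := by ring
  have h4 := le_of_mul_le_mul_left h3 hH
  linarith


/-! ### The lower bound for the Nitsche form -/

/-- The discrete trace inequality `‖h^(1/2) Dv‖²_Γ ≤ C ‖Dv‖²_Ω`, with a measurable majorant of the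
integrand on the left. -/
theorem exists_trace_inequality (d k m : ℕ) (hd : 0 < d) (κ : ℝ) : ∃ C : ℝ, 0 < C ∧
    ∀ (M : Mesh d) (Ω Γ : Set (E d)) (hΓ : E d → ℝ) (v : E d → E d), M.IsShapeRegular Ω m κ →
      IsLipschitzDomain Ω → Γ ⊆ frontier Ω → MeasurableSet Γ → M.IsBoundaryMeshSize Γ κ hΓ →
      M.IsFEFunction k v → ∃ b : E d → ℝ, Integrable b ((surf d).restrict Γ) ∧
        (∀ᵐ x ∂((surf d).restrict Γ), hΓ x * frobNorm (symGrad Ω v x) ^ 2 ≤ b x) ∧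
        ∫ x in Γ, b x ∂(surf d) ≤ C * symGradSq Ω v := by
  obtain ⟨C₀, hC₀, hinv⟩ := exists_inverse_estimate d k m hd κ
  have hσ : ∃ σ : ℝ, 0 ≤ σ ∧ ∀ s : RefShape,
      surf d (s.toSet d \ interior (s.toSet d)) ≤ ENNReal.ofReal σ := by
    set S := fun s : RefShape => surf d (s.toSet d \ interior (s.toSet d)) with hS
    refine ⟨(S .simplex).toReal + (S .cube).toReal, by positivity, fun s => ?_⟩
    have hfin : ∀ s, S s ≠ ⊤ := fun s => s.surf_diff_interior_lt_top.ne
    rw [ENNReal.ofReal_add (by positivity) (by positivity), ENNReal.ofReal_toReal (hfin _),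
      ENNReal.ofReal_toReal (hfin _)]
    cases s
    · exact le_self_add
    · exact le_add_self
  obtain ⟨σ, hσ0, hσ⟩ := hσ
  -- Of the `d` powers of `κ`, one comes from `hΓ ≤ κ h` and `d - 1` from the Lipschitz scaling of
  -- the surface measure; the powers of `h` cancel.
  refine ⟨C₀ * |κ| ^ d * σ + 1, by positivity, fun M Ω Γ hΓ v hM hΩ hsub hm hh hv => ?_⟩
  have := M.finite
  have := Fintype.ofFinite M.Cell
  set I : M.Cell → ℝ := fun c => ∫ x in M.openCell c, frobNorm (symGrad Ω v x) ^ 2 with hI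
  have hI0 : ∀ c, 0 ≤ I c := fun c => integral_nonneg fun x => sq_nonneg _
  set a : M.Cell → ℝ := fun c => κ * M.diam c * (C₀ * I c / M.diam c ^ d) with ha
  have ha0 : ∀ c, 0 ≤ a c := fun c => by
    have := hM.diam_pos hd c
    have := hM.kappa_pos hd c
    have := hI0 c
    positivity
  have hfin : ∀ c, surf d (Γ ∩ M.cell c) ≤ ENNReal.ofReal ((κ * M.diam c) ^ (d - 1) * σ) := by
    intro c
    have h1 := hM.diam_pos hd c
    have h2 := hM.kappa_pos hd c
    refine (measure_mono (inter_subset_inter_left _ hsub)).trans ?_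
    refine (hM.surf_frontier_inter_cell_le hd hΩ c).trans ?_
    rw [ENNReal.ofReal_mul (by positivity)]
    exact mul_le_mul_right (hσ (M.shape c)) _
  have hcm : ∀ c, MeasurableSet (M.cell c) := fun c => (hM.isCompact_cell c).measurableSet
  have hbi : ∀ c, Integrable ((M.cell c).indicator fun _ => a c) ((surf d).restrict Γ) := by
    intro c
    rw [integrable_indicator_iff (hcm c)]
    refine integrableOn_const (ne_of_lt ?_)
    rw [Measure.restrict_apply (hcm c), inter_comm]
    exact (hfin c).trans_lt ENNReal.ofReal_lt_top
  -- The majorant is constant on each cell, so measurability of the one-sided gradient on the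
  -- boundary plays no role; overlaps of cells only increase it.
  refine ⟨fun x => ∑ c, (M.cell c).indicator (fun _ => a c) x,
    integrable_finsetSum _ fun c _ => hbi c, ?_, ?_⟩
  · filter_upwards [hh.2, ae_restrict_mem hm] with x hx hxΓ
    have hxc : x ∈ ⋃ c, M.cell c := hM.cover ▸ frontier_subset_closure (hsub hxΓ)
    obtain ⟨c, hc⟩ := mem_iUnion.1 hxc
    have h1 := hM.diam_pos hd c
    have h2 := hM.kappa_pos hd c
    have h3 : hΓ x * frobNorm (symGrad Ω v x) ^ 2 ≤ a c := by
      refine mul_le_mul (hx.2 c hc).1 ?_ (sq_nonneg _) (by positivity)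
      rw [le_div_iff₀ (by positivity), mul_comm]
      exact hinv M Ω v hM hΩ hv c x hc
    refine h3.trans ?_
    have h4 := Finset.single_le_sum (f := fun c => (M.cell c).indicator (fun _ => a c) x)
      (fun c _ => indicator_nonneg (fun _ _ => ha0 c) x) (Finset.mem_univ c)
    rwa [indicator_of_mem hc] at h4
  · rw [integral_finsetSum _ fun c _ => hbi c]
    have hc : ∀ c, ∫ x in Γ, (M.cell c).indicator (fun _ => a c) x ∂(surf d)
        ≤ (C₀ * |κ| ^ d * σ + 1) * I c := by
      intro c
      have h1 := hM.diam_pos hd c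
      have h2 := hM.kappa_pos hd c
      rw [integral_indicator (hcm c), setIntegral_const, smul_eq_mul, measureReal_def,
        Measure.restrict_apply (hcm c), inter_comm]
      have h3 : (surf d (Γ ∩ M.cell c)).toReal ≤ (κ * M.diam c) ^ (d - 1) * σ :=
        ENNReal.toReal_le_of_le_ofReal (by positivity) (hfin c)
      refine (mul_le_mul_of_nonneg_right h3 (ha0 c)).trans ?_
      have h4 : (κ * M.diam c) ^ (d - 1) * σ * a c = C₀ * κ ^ d * σ * I c := by
        have h5 : (κ * M.diam c) ^ (d - 1) * (κ * M.diam c) = κ ^ d * M.diam c ^ d := by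
          rw [← pow_succ, Nat.sub_add_cancel hd, mul_pow]
        calc (κ * M.diam c) ^ (d - 1) * σ * a c
            = ((κ * M.diam c) ^ (d - 1) * (κ * M.diam c)) * σ * (C₀ * I c / M.diam c ^ d) := by
              rw [ha]; ring
          _ = _ := by rw [h5]; field_simp
      rw [h4, abs_of_pos h2]
      nlinarith [hI0 c]
    refine (Finset.sum_le_sum fun c _ => hc c).trans ?_
    rw [← Finset.mul_sum]
    exact mul_le_mul_of_nonneg_left (hM.sum_openCell_le hd hΩ hv) (by positivity)

/-! ### Measurability, integrability and the two positive terms of the form -/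

theorem aestronglyMeasurable_frob {d : ℕ} {μ : Measure (E d)} {A B : E d → SymMat d}
    (hA : AEStronglyMeasurable A μ) (hB : AEStronglyMeasurable B μ) :
    AEStronglyMeasurable (fun x => frob (A x) (B x)) μ :=
  Continuous.comp_aestronglyMeasurable₂ (g := fun A B : SymMat d => frob A B) continuous_frob hA hB

/-- Evaluation of a measurable field of linear maps at a measurable field. -/
theorem aestronglyMeasurable_tangent_apply {d : ℕ} {μ : Measure (E d)}
    {T : E d → SymMat d →ₗ[ℝ] SymMat d} {A : E d → SymMat d}
    (hT : ∀ B, AEStronglyMeasurable (fun x => T x B) μ) (hA : AEStronglyMeasurable A μ) :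
    AEStronglyMeasurable (fun x => T x (A x)) μ := by
  let b := Module.finBasis ℝ (SymMat d)
  have h : (fun x => T x (A x)) = fun x => ∑ i, b.repr (A x) i • T x (b i) := by
    funext x
    conv_lhs => rw [← b.sum_repr (A x), map_sum]
    simp only [map_smul]
  rw [h]
  have hcoord : ∀ i, Continuous fun B : SymMat d => b.repr B i := fun i =>
    (b.coord i).continuous_of_finiteDimensional
  refine Finset.aestronglyMeasurable_fun_sum _ fun i _ => ?_
  exact ((hcoord i).comp_aestronglyMeasurable hA).smul (hT (b i))

/-- Where no normal exists the default value is zero, so the bound holds everywhere and existence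
almost everywhere need not be invoked. -/
theorem norm_outerNormal_le {d : ℕ} (Ω : Set (E d)) (x : E d) : ‖outerNormal Ω x‖ ≤ 1 := by
  rw [outerNormal]
  split_ifs with h
  · exact h.choose_spec.1.le
  · simp

section Boundary

variable {d : ℕ} {M : Mesh d} {Ω Γ : Set (E d)} {k m : ℕ} {κ : ℝ} {hΓ : E d → ℝ} {v : E d → E d}

theorem Mesh.IsShapeRegular.aestronglyMeasurable_bdry (hM : M.IsShapeRegular Ω m κ)
    (hsub : Γ ⊆ frontier Ω) (hv : M.IsFEFunction k v) :
    AEStronglyMeasurable v ((surf d).restrict Γ) :=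
  ((hM.continuousOn_of_isFEFunction hv).aestronglyMeasurable
    isClosed_closure.measurableSet).mono_measure
      (Measure.restrict_mono (hsub.trans frontier_subset_closure) le_rfl)

theorem Mesh.IsShapeRegular.exists_norm_le (hM : M.IsShapeRegular Ω m κ)
    (hΩ : IsLipschitzDomain Ω) (hv : M.IsFEFunction k v) :
    ∃ b : ℝ, ∀ x ∈ closure Ω, ‖v x‖ ≤ b :=
  hΩ.isBounded.isCompact_closure.exists_bound_of_continuousOn (hM.continuousOn_of_isFEFunction hv)

theorem Mesh.IsShapeRegular.isFiniteMeasure_bdry (hM : M.IsShapeRegular Ω m κ) (hd : 0 < d)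
    (hΩ : IsLipschitzDomain Ω) (hsub : Γ ⊆ frontier Ω) :
    IsFiniteMeasure ((surf d).restrict Γ) :=
  isFiniteMeasure_restrict.2
    ((measure_mono hsub).trans_lt (hM.surf_frontier_lt_top hd hΩ)).ne

/-- Bounded functions, weighted with the inverse mesh size, are integrable on the boundary. -/
theorem Mesh.IsShapeRegular.integrable_inv_mul (hM : M.IsShapeRegular Ω m κ) (hd : 0 < d)
    (hΩ : IsLipschitzDomain Ω) (hsub : Γ ⊆ frontier Ω) (hm : MeasurableSet Γ)
    (hh : M.IsBoundaryMeshSize Γ κ hΓ) {φ : E d → ℝ} {b : ℝ}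
    (hφ : AEStronglyMeasurable φ ((surf d).restrict Γ)) (hb : ∀ x ∈ Γ, |φ x| ≤ b) :
    Integrable (fun x => (hΓ x)⁻¹ * φ x) ((surf d).restrict Γ) := by
  have := M.finite
  have := Fintype.ofFinite M.Cell
  have := hM.isFiniteMeasure_bdry hd hΩ hsub
  have hpos : ∀ c, 0 ≤ κ / M.diam c := fun c =>
    (div_pos (hM.kappa_pos hd c) (hM.diam_pos hd c)).le
  refine Integrable.of_bound (hh.1.inv.aestronglyMeasurable.mul hφ)
    ((∑ c, κ / M.diam c) * b) ?_
  filter_upwards [hh.2, ae_restrict_mem hm] with x hx hxΓ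
  have hxc : x ∈ ⋃ c, M.cell c := hM.cover ▸ frontier_subset_closure (hsub hxΓ)
  obtain ⟨c, hc⟩ := mem_iUnion.1 hxc
  have h1 := hM.diam_pos hd c
  have h2 : (hΓ x)⁻¹ ≤ κ / M.diam c := by
    rw [inv_eq_one_div, div_le_div_iff₀ hx.1 h1]
    linarith [(hx.2 c hc).2]
  rw [norm_mul, Real.norm_eq_abs, Real.norm_eq_abs, abs_of_pos (inv_pos.2 hx.1)]
  refine mul_le_mul (h2.trans ?_) (hb x hxΓ) (abs_nonneg _)
    (Finset.sum_nonneg fun c _ => hpos c)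
  exact Finset.single_le_sum (fun c _ => hpos c) (Finset.mem_univ c)

theorem Mesh.IsShapeRegular.integrable_bdrySq (hM : M.IsShapeRegular Ω m κ) (hd : 0 < d)
    (hΩ : IsLipschitzDomain Ω) (hsub : Γ ⊆ frontier Ω) (hm : MeasurableSet Γ)
    (hh : M.IsBoundaryMeshSize Γ κ hΓ) (hv : M.IsFEFunction k v) :
    Integrable (fun x => (hΓ x)⁻¹ * ‖v x‖ ^ 2) ((surf d).restrict Γ) := by
  obtain ⟨b, hb⟩ := hM.exists_norm_le hΩ hv
  refine hM.integrable_inv_mul hd hΩ hsub hm hh (b := b ^ 2)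
    ((hM.aestronglyMeasurable_bdry hsub hv).norm.pow 2) fun x hx => ?_
  rw [abs_of_nonneg (sq_nonneg _)]
  exact pow_le_pow_left₀ (norm_nonneg _) (hb x (frontier_subset_closure (hsub hx))) 2

theorem bdrySq_nonneg (hh : M.IsBoundaryMeshSize Γ κ hΓ) : 0 ≤ bdrySq Γ hΓ v := by
  refine integral_nonneg_of_ae ?_
  filter_upwards [hh.2] with x hx
  have := hx.1
  change 0 ≤ (hΓ x)⁻¹ * ‖v x‖ ^ 2
  positivity

theorem bdryNormalSq_nonneg (hh : M.IsBoundaryMeshSize Γ κ hΓ) : 0 ≤ bdryNormalSq Ω Γ hΓ v := by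
  refine integral_nonneg_of_ae ?_
  filter_upwards [hh.2] with x hx
  have := hx.1
  change 0 ≤ (hΓ x)⁻¹ * (inner ℝ (v x) (outerNormal Ω x)) ^ 2
  positivity

theorem symGradSq_nonneg : 0 ≤ symGradSq Ω v := integral_nonneg fun _ => sq_nonneg _

variable {R : Rheology} {ηbar : ℝ} {T : E d → SymMat d →ₗ[ℝ] SymMat d} {g : E d → E d}
  {G : E d → SymMat d}

/-- The pointwise lower bound integrates only once the integrand is known to be integrable; this
uses the upper tangent bound. -/
theorem le_integral_tangent (hM : M.IsShapeRegular Ω m κ) (hd : 0 < d) (hΩ : IsLipschitzDomain Ω)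
    (hv : M.IsFEFunction k v) (hN : IsNewtonData R Ω Γ ηbar T g G) :
    R.νInf * symGradSq Ω v ≤ ∫ x in Ω, frob (T x (symGrad Ω v x)) (symGrad Ω v x) := by
  have hint := hM.integrable_frobNorm_symGrad_sq hd hΩ hv
  have hD := hM.aestronglyMeasurable_symGrad (v := v) hd
  have hTD := aestronglyMeasurable_tangent_apply hN.tangent_meas hD
  have hfm : AEStronglyMeasurable (fun x => frob (T x (symGrad Ω v x)) (symGrad Ω v x))
      (volume.restrict Ω) :=
    aestronglyMeasurable_frob hTD hD
  have hfi : Integrable (fun x => frob (T x (symGrad Ω v x)) (symGrad Ω v x))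
      (volume.restrict Ω) := by
    refine (hint.const_mul ηbar).mono' hfm ?_
    filter_upwards [hN.bounds] with x hx
    have h1 := (hx (symGrad Ω v x)).2
    have h2 := frobNorm_nonneg (R.dStress (G x) (symGrad Ω v x))
    rw [Real.norm_eq_abs]
    refine (abs_frob_le _ _).trans ?_
    rw [sq, ← mul_assoc]
    exact mul_le_mul_of_nonneg_right (by linarith) (frobNorm_nonneg _)
  have hle : ∀ᵐ x ∂(volume.restrict Ω), R.νInf * frobNorm (symGrad Ω v x) ^ 2
      ≤ frob (T x (symGrad Ω v x)) (symGrad Ω v x) := by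
    filter_upwards [hN.bounds] with x hx
    exact (hx (symGrad Ω v x)).1
  have h := integral_mono_ae (hint.const_mul R.νInf) hfi hle
  rwa [integral_const_mul] at h

/-- The inequality is `η ≥ ν_∞`; the upper bound on `η` serves integrability only. -/
theorem le_integral_penalty (hM : M.IsShapeRegular Ω m κ) (hd : 0 < d) (hΩ : IsLipschitzDomain Ω)
    (hsub : Γ ⊆ frontier Ω) (hm : MeasurableSet Γ) (hh : M.IsBoundaryMeshSize Γ κ hΓ)
    (hv : M.IsFEFunction k v) (hG : AEStronglyMeasurable G ((surf d).restrict Γ)) :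
    R.νInf * bdrySq Γ hΓ v
      ≤ ∫ x in Γ, (hΓ x)⁻¹ * R.effVisc (G x) * inner ℝ (v x) (v x) ∂(surf d) := by
  obtain ⟨b, hb⟩ := hM.exists_norm_le hΩ hv
  have hpos := fun x => (R.effVisc_pos (G x)).le
  rw [bdrySq, ← integral_const_mul]
  refine integral_mono_ae ((hM.integrable_bdrySq hd hΩ hsub hm hh hv).const_mul _) ?_ ?_
  · simp only [mul_assoc, real_inner_self_eq_norm_sq]
    refine hM.integrable_inv_mul hd hΩ hsub hm hh
      (b := (R.νInf + R.ν * (R.δ ^ 2) ^ ((R.p - 2) / 2)) * b ^ 2)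
      ((R.continuous_effVisc.comp_aestronglyMeasurable hG).mul
        ((hM.aestronglyMeasurable_bdry hsub hv).norm.pow 2)) fun x hx => ?_
    have h1 := hpos x
    have h2 : R.effVisc (G x) ≤ R.νInf + R.ν * (R.δ ^ 2) ^ ((R.p - 2) / 2) :=
      add_le_add_right (R.shearVisc_le (G x)) _
    rw [abs_of_nonneg (by positivity)]
    refine mul_le_mul h2 ?_ (by positivity) (h1.trans h2)
    exact pow_le_pow_left₀ (norm_nonneg _) (hb x (frontier_subset_closure (hsub hx))) 2
  · filter_upwards [hh.2] with x hx
    have h1 : R.νInf ≤ R.effVisc (G x) := by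
      have := R.shearVisc_pos (G x)
      rw [Rheology.effVisc]
      linarith
    have h2 : 0 ≤ (hΓ x)⁻¹ * ‖v x‖ ^ 2 := by
      have := hx.1
      positivity
    rw [real_inner_self_eq_norm_sq, mul_right_comm, mul_comm]
    exact mul_le_mul_of_nonneg_left h1 h2

end Boundary

/-- The discrete Gårding-type inequality for the Nitsche form. -/
theorem exists_nitscheForm_lower_bound (d k m : ℕ) (hd : 0 < d) (κ : ℝ) :
    ∃ C : ℝ → ℝ, (∀ θ, 0 < C θ) ∧
      ∀ (R : Rheology) (Ω Γ : Set (E d)) (M : Mesh d) (hΓ : E d → ℝ) (ηbar : ℝ)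
        (T : E d → SymMat d →ₗ[ℝ] SymMat d) (g : E d → E d) (G : E d → SymMat d)
        (γ₁ γ₂ : ℝ) (v : E d → E d),
        IsLipschitzDomain Ω → Γ ⊆ frontier Ω → MeasurableSet Γ →
        M.IsShapeRegular Ω m κ → M.IsBoundaryMeshSize Γ κ hΓ → M.IsFEFunction k v →
        IsNewtonData R Ω Γ ηbar T g G → 0 < γ₁ →
          R.νInf / 2 * symGradSq Ω v
              + (γ₁ * R.νInf - R.νInf * C (ηbar / R.νInf)) * bdrySq Γ hΓ v
              + γ₂ * bdryNormalSq Ω Γ hΓ v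
            ≤ nitscheForm R Ω Γ hΓ T G γ₁ γ₂ v v := by
  obtain ⟨C, hC, htr⟩ := exists_trace_inequality d k m hd κ
  -- The term `2Cθ²` is the total boundary cost of the two consistency terms after Young's
  -- inequality; the `+ 1` keeps the constant positive at `θ = 0`.
  refine ⟨fun θ => 2 * C * θ ^ 2 + 1, fun θ => by positivity,
    fun R Ω Γ M hΓ ηbar T g G γ₁ γ₂ v hΩ hsub hm hM hh hv hN hγ₁ => ?_⟩
  obtain ⟨b, hbi, hb, hbC⟩ := htr M Ω Γ hΓ v hM hΩ hsub hm hh hv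
  have hν := R.νInf_pos
  have hsq := hM.integrable_bdrySq hd hΩ hsub hm hh hv
  -- Young majorant of `ηbar |Dv| |v|`. The weight `ν_∞/(2C)` makes its gradient part integrate to
  -- at most `ν_∞/4 ‖Dv‖²`, so two such terms use half of the volume term.
  set q : E d → ℝ := fun x => 1 / 2 * (R.νInf / (2 * C) * b x
    + 2 * C * ηbar ^ 2 / R.νInf * ((hΓ x)⁻¹ * ‖v x‖ ^ 2)) with hq
  have hqi : Integrable q ((surf d).restrict Γ) :=
    ((hbi.const_mul _).add (hsq.const_mul _)).const_mul _
  have hqC : ∫ x in Γ, q x ∂(surf d) ≤ 1 / 2 * (R.νInf / 2 * symGradSq Ω v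
      + R.νInf * (2 * C * (ηbar / R.νInf) ^ 2) * bdrySq Γ hΓ v) := by
    rw [hq, integral_const_mul, integral_add (hbi.const_mul _) (hsq.const_mul _),
      integral_const_mul, integral_const_mul]
    refine mul_le_mul_of_nonneg_left (add_le_add ?_ (le_of_eq ?_)) (by norm_num)
    · refine (mul_le_mul_of_nonneg_left hbC (by positivity)).trans_eq ?_
      field_simp
    · rw [bdrySq]
      field_simp
  have hyoung : ∀ᵐ x ∂((surf d).restrict Γ),
      ηbar * frobNorm (symGrad Ω v x) * ‖v x‖ ≤ q x := by
    filter_upwards [hb, hh.2] with x hx hx'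
    have h0 := hx'.1
    have h1 : R.νInf / (2 * C) * (hΓ x * frobNorm (symGrad Ω v x) ^ 2)
        ≤ R.νInf / (2 * C) * b x := mul_le_mul_of_nonneg_left hx (by positivity)
    have h2 : R.νInf / (2 * C) * (hΓ x * frobNorm (symGrad Ω v x) ^ 2)
        + 2 * C * ηbar ^ 2 / R.νInf * ((hΓ x)⁻¹ * ‖v x‖ ^ 2)
        - 2 * (ηbar * frobNorm (symGrad Ω v x) * ‖v x‖)
        = (R.νInf * hΓ x * frobNorm (symGrad Ω v x) - 2 * C * ηbar * ‖v x‖) ^ 2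
          / (2 * C * R.νInf * hΓ x) := by
      field_simp
      ring
    have h3 : 0 ≤ (R.νInf * hΓ x * frobNorm (symGrad Ω v x) - 2 * C * ηbar * ‖v x‖) ^ 2
          / (2 * C * R.νInf * hΓ x) := by positivity
    rw [hq]
    linarith
  have hbd := hN.bound_trace hΩ.isOpen (hsub.trans frontier_subset_closure) hm
  have hpair : ∀ A : E d → SymMat d, (∀ᵐ x ∂((surf d).restrict Γ),
      frobNorm (A x) ≤ ηbar * frobNorm (symGrad Ω v x)) →
      ∫ x in Γ, normalPairing (A x) (outerNormal Ω x) (v x) ∂(surf d)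
        ≤ ∫ x in Γ, q x ∂(surf d) := by
    intro A hA
    -- Only the majorant has to be integrable here; nothing is asked of the boundary pairing.
    refine (Real.le_norm_self _).trans (norm_integral_le_of_norm_le hqi ?_)
    filter_upwards [hA, hyoung] with x hx hx'
    refine (abs_normalPairing_le _ _ _).trans (le_trans ?_ hx')
    refine mul_le_mul_of_nonneg_right ?_ (norm_nonneg _)
    refine le_trans ?_ hx
    exact mul_le_of_le_one_right (frobNorm_nonneg _) (norm_outerNormal_le Ω x)
  have h1 := hpair (fun x => T x (symGrad Ω v x)) (by
    filter_upwards [hbd] with x hx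
    linarith [hx (symGrad Ω v x), frobNorm_nonneg (R.dStress (G x) (symGrad Ω v x))])
  have h2 := hpair (fun x => R.dStress (G x) (symGrad Ω v x)) (by
    filter_upwards [hbd] with x hx
    linarith [hx (symGrad Ω v x), frobNorm_nonneg (T x (symGrad Ω v x))])
  have h3 := le_integral_tangent hM hd hΩ hv hN
  have h4 := mul_le_mul_of_nonneg_left
    (le_integral_penalty (R := R) hM hd hΩ hsub hm hh hv hN.lifting_meas_bdry) hγ₁.le
  have h5 : ∫ x in Γ, (hΓ x)⁻¹ * (inner ℝ (v x) (outerNormal Ω x)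
      * inner ℝ (v x) (outerNormal Ω x)) ∂(surf d) = bdryNormalSq Ω Γ hΓ v := by
    simp only [bdryNormalSq, sq]
  have h6 : 0 ≤ R.νInf * bdrySq Γ hΓ v := mul_nonneg hν.le (bdrySq_nonneg hh)
  rw [nitscheForm, h5]
  nlinarith


/-! ### Infinitesimal rigid motions -/

section Rigid

variable {d : ℕ}

/-- On `U`, the field `v` is an infinitesimal rigid motion. -/
def IsRigidOn (v : E d → E d) (U : Set (E d)) : Prop :=
  ∃ (a : E d) (W : E d →L[ℝ] E d), (∀ z, inner ℝ (W z) z = 0) ∧ ∀ x ∈ U, v x = a + W x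

/-- Orthogonality of increments polarizes to `u(z)·y = -u(y)·z` for `u(z) = v(x₀+z) - v(x₀)`. Taking
`y` along the coordinate axes shows that `u` is linear; no smoothness of `v` is needed. -/
theorem isRigidOn_ball {v : E d → E d} {x₀ : E d} {r : ℝ} (hr : 0 < r)
    (h : ∀ x ∈ Metric.ball x₀ r, ∀ y ∈ Metric.ball x₀ r, inner ℝ (v y - v x) (y - x) = 0) :
    IsRigidOn v (Metric.ball x₀ r) := by
  set u : E d → E d := fun z => v (x₀ + z) - v x₀ with hu
  have hball : ∀ z : E d, ‖z‖ < r → x₀ + z ∈ Metric.ball x₀ r := fun z hz => by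
    simpa [Metric.mem_ball, dist_eq_norm] using hz
  have h0 : ∀ z, ‖z‖ < r → inner ℝ (u z) z = 0 := by
    intro z hz
    have := h x₀ (Metric.mem_ball_self hr) _ (hball z hz)
    simpa [hu] using this
  have hskew : ∀ y z, ‖y‖ < r → ‖z‖ < r → inner ℝ (u z) y = -inner ℝ (u y) z := by
    intro y z hy hz
    have h1 := h _ (hball z hz) _ (hball y hy)
    have h2 : v (x₀ + y) - v (x₀ + z) = u y - u z := by simp [hu]
    rw [h2, add_sub_add_left_eq_sub, inner_sub_left, inner_sub_right, inner_sub_right, h0 y hy,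
      h0 z hz] at h1
    linarith
  set s := r / 2 with hs
  have hs0 : 0 < s := by positivity
  have he : ∀ i : Fin d, ‖s • (EuclideanSpace.single i (1 : ℝ) : E d)‖ < r := by
    intro i
    rw [norm_smul, PiLp.norm_single, norm_one, mul_one, Real.norm_of_nonneg hs0.le, hs]
    linarith
  let W : E d →L[ℝ] E d := ∑ i, (innerSL ℝ (-(s⁻¹ • u (s • EuclideanSpace.single i (1 : ℝ)))) :
    E d →L[ℝ] ℝ).smulRight (EuclideanSpace.single i (1 : ℝ))
  have hW : ∀ z, ‖z‖ < r → u z = W z := by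
    intro z hz
    ext i
    have h1 : u z i = s⁻¹ * inner ℝ (u z) (s • EuclideanSpace.single i (1 : ℝ)) := by
      rw [real_inner_smul_right, EuclideanSpace.inner_single_right]
      simp [hs0.ne']
    rw [h1, hskew _ _ (he i) hz]
    simp [W, Finset.sum_apply, Pi.single_apply, Finset.sum_ite_eq]
  refine ⟨v x₀ - W x₀, W, fun z => ?_, fun x hx => ?_⟩
  · set t := s / (‖z‖ + 1) with ht
    have ht0 : 0 < t := by positivity
    have htz : ‖t • z‖ < r := by
      rw [norm_smul, Real.norm_of_nonneg ht0.le, ht, div_mul_eq_mul_div,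
        div_lt_iff₀ (by positivity)]
      nlinarith [norm_nonneg z]
    have h1 := h0 _ htz
    rw [hW _ htz, map_smul, real_inner_smul_left, real_inner_smul_right] at h1
    simpa [ht0.ne'] using h1
  · have hx' : ‖x - x₀‖ < r := by rwa [← dist_eq_norm]
    have h1 := hW _ hx'
    simp only [hu, add_sub_cancel, map_sub] at h1
    rw [sub_eq_iff_eq_add] at h1
    rw [h1]
    abel

theorem analyticAt_affine (a : E d) (W : E d →L[ℝ] E d) (x : E d) :
    AnalyticAt ℝ (fun z => a + W z) x :=
  analyticAt_const.add (W.analyticAt x)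

/-- Local rigidity on a connected open set is global. -/
theorem isRigidOn_of_locally {v : E d → E d} {U : Set (E d)} (hU : IsPreconnected U)
    (h : ∀ x ∈ U, ∃ r > 0, IsRigidOn v (Metric.ball x r)) : IsRigidOn v U := by
  rcases U.eq_empty_or_nonempty with rfl | ⟨x₀, hx₀⟩
  · exact ⟨0, 0, by simp, by simp⟩
  -- Locally `v` is affine, hence analytic, and the identity theorem propagates one local rigid
  -- motion to all of `U`.
  have hv : AnalyticOnNhd ℝ v U := by
    intro x hx
    obtain ⟨r, hr, a, W, -, hW⟩ := h x hx
    refine (analyticAt_affine a W x).congr ?_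
    filter_upwards [Metric.ball_mem_nhds x hr] with z hz
    exact (hW z hz).symm
  obtain ⟨r, hr, a, W, hs, hW⟩ := h x₀ hx₀
  refine ⟨a, W, hs, fun x hx => ?_⟩
  refine hv.eqOn_of_preconnected_of_eventuallyEq (fun z _ => analyticAt_affine a W z) hU hx₀ ?_ hx
  filter_upwards [Metric.ball_mem_nhds x₀ hr] with z hz
  exact hW z hz

theorem IsRigidOn.of_subset_closure {v : E d → E d} {U V : Set (E d)} (h : IsRigidOn v U)
    (hv : ContinuousOn v V) (hUV : U ⊆ V) (hVU : V ⊆ closure U) : IsRigidOn v V := by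
  obtain ⟨a, W, hs, hW⟩ := h
  have hc : Continuous fun z => a + W z := by fun_prop
  exact ⟨a, W, hs, EqOn.of_subset_closure (fun x hx => hW x hx) hv hc.continuousOn hUV hVU⟩

/-- A quadratic form sees only the symmetric part of its matrix. -/
theorem inner_eq_sum_symPart (L : E d →L[ℝ] E d) (w : E d) :
    inner ℝ (L w) w = ∑ i, ∑ j, (symPart (matOf L)).1 i j * (w i * w j) := by
  have hw : L w = ∑ j, w j • L (EuclideanSpace.single j 1) := by
    have h : w = ∑ j, w j • EuclideanSpace.single j (1 : ℝ) := by
      simpa using ((EuclideanSpace.basisFun (Fin d) ℝ).sum_repr w).symm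
    conv_lhs => rw [h, map_sum]
    simp only [map_smul]
  have h1 : inner ℝ (L w) w = ∑ i, ∑ j, matOf L i j * (w i * w j) := by
    rw [PiLp.inner_apply]
    refine Finset.sum_congr rfl fun i _ => ?_
    have h2 : (L w) i = ∑ j, w j * matOf L i j := by
      rw [hw]
      simp [matOf_apply]
    rw [RCLike.inner_apply, conj_trivial, h2, Finset.mul_sum]
    exact Finset.sum_congr rfl fun j _ => by ring
  have h2 : ∑ i, ∑ j, matOf L i j * (w i * w j) = ∑ i, ∑ j, matOf L j i * (w i * w j) := by
    rw [Finset.sum_comm]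
    exact Finset.sum_congr rfl fun i _ => Finset.sum_congr rfl fun j _ => by ring
  have h3 : ∑ i, ∑ j, (symPart (matOf L)).1 i j * (w i * w j)
      = 1 / 2 * (∑ i, ∑ j, matOf L i j * (w i * w j) + ∑ i, ∑ j, matOf L j i * (w i * w j)) := by
    rw [← Finset.sum_add_distrib, Finset.mul_sum]
    refine Finset.sum_congr rfl fun i _ => ?_
    rw [← Finset.sum_add_distrib, Finset.mul_sum]
    refine Finset.sum_congr rfl fun j _ => ?_
    simp only [symPart, Matrix.smul_apply, Matrix.add_apply, Matrix.transpose_apply, smul_eq_mul]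
    ring
  rw [h3, ← h2, h1]
  ring

/-- A field with vanishing symmetric gradient on a connected open set is rigid. -/
theorem isRigidOn_of_symPart_fderiv_eq_zero {v : E d → E d} {U : Set (E d)} (hU : IsOpen U)
    (hc : IsPreconnected U) (hv : ∀ x ∈ U, DifferentiableAt ℝ v x)
    (h : ∀ x ∈ U, symPart (matOf (fderiv ℝ v x)) = 0) : IsRigidOn v U := by
  refine isRigidOn_of_locally hc fun x₀ hx₀ => ?_
  obtain ⟨r, hr, hball⟩ := Metric.isOpen_iff.1 hU x₀ hx₀
  refine ⟨r, hr, isRigidOn_ball hr fun x hx y hy => ?_⟩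
  set w := y - x with hw
  have hd : ∀ z ∈ Metric.ball x₀ r, HasFDerivWithinAt (fun z => inner ℝ w (v z))
      ((innerSL ℝ w : E d →L[ℝ] ℝ).comp (fderiv ℝ v z)) (Metric.ball x₀ r) z := fun z hz =>
    ((innerSL ℝ w : E d →L[ℝ] ℝ).hasFDerivAt.comp z
      (hv z (hball hz)).hasFDerivAt).hasFDerivWithinAt
  -- The mean value theorem for `w · v` along the segment gives `(v y - v x)·w = w·(Dv(z) w)`, which
  -- vanishes with the symmetric gradient.
  obtain ⟨z, hz, hzw⟩ := domain_mvt hd (convex_ball x₀ r) hx hy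
  have hzU : z ∈ U := hball ((convex_ball x₀ r).segment_subset hx hy hz)
  have h1 : inner ℝ w (fderiv ℝ v z w) = 0 := by
    rw [real_inner_comm, inner_eq_sum_symPart, h z hzU]
    simp
  rw [ContinuousLinearMap.comp_apply, innerSL_apply_apply, ← hw, h1, ← inner_sub_right] at hzw
  rw [real_inner_comm]
  exact hzw

/-- The increments of a continuous field that is rigid on each of finitely many sets are orthogonal
to the segments covered by these sets. -/
theorem inner_sub_eq_zero_of_rigid_pieces {ι : Type*} [Finite ι] {K : ι → Set (E d)}
    {v : E d → E d} (hv : ContinuousOn v (⋃ i, K i)) (hr : ∀ i, IsRigidOn v (K i)) {x y : E d}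
    (hxy : segment ℝ x y ⊆ ⋃ i, K i) : inner ℝ (v y - v x) (y - x) = 0 := by
  choose a W hs hW using hr
  set w := y - x with hw
  -- Along the segment, `v · w` is constant on each piece because `W w ⟂ w`. A continuous function
  -- with finitely many values on a connected set is constant, so interfaces between pieces need no
  -- analysis.
  set T : Set ℝ := range fun i => inner ℝ (a i + W i x) w with hT
  have hTd : IsDiscrete T := (finite_range _).isDiscrete
  have hconv : IsPreconnected (segment ℝ x y) := (convex_segment x y).isPreconnected
  have hmaps : MapsTo (fun z => inner ℝ (v z) w) (segment ℝ x y) T := by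
    intro z hz
    obtain ⟨i, hi⟩ := mem_iUnion.1 (hxy hz)
    refine ⟨i, ?_⟩
    rw [segment_eq_image'] at hz
    obtain ⟨t, -, rfl⟩ := hz
    simp only
    rw [hW i _ hi, map_add, map_smul, ← hw, inner_add_left, inner_add_left, inner_add_left,
      real_inner_smul_left, hs i w, mul_zero, add_zero]
  have hcont : ContinuousOn (fun z => inner ℝ (v z) w) (segment ℝ x y) :=
    (hv.mono hxy).inner continuousOn_const
  have h : inner ℝ (v x) w = inner ℝ (v y) w :=
    hconv.constant_of_mapsTo hTd hcont hmaps (left_mem_segment ℝ x y)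
      (right_mem_segment ℝ x y)
  rw [inner_sub_left, h, sub_self]

/-- A rigid motion that vanishes on a set of positive surface measure is zero. -/
theorem eq_zero_of_surf_pos (hd : 2 ≤ d) {a : E d} {W : E d →L[ℝ] E d}
    (hs : ∀ z, inner ℝ (W z) z = 0) {Z : Set (E d)} (hZ : surf d Z ≠ 0)
    (h : ∀ x ∈ Z, a + W x = 0) : a = 0 ∧ W = 0 := by
  have hne : Z.Nonempty := nonempty_of_measure_ne_zero hZ
  obtain ⟨z₀, hz₀⟩ := hne
  by_cases hW : W = 0
  · refine ⟨?_, hW⟩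
    simpa [hW] using h z₀ hz₀
  exfalso
  obtain ⟨u, hu⟩ : ∃ u, W u ≠ 0 := by
    by_contra! h0
    exact hW (ContinuousLinearMap.ext h0)
  have hskew : ∀ y z, inner ℝ (W y) z = -inner ℝ (W z) y := by
    intro y z
    have h1 := hs (y + z)
    rw [map_add, inner_add_left, inner_add_right, inner_add_right, hs y, hs z] at h1
    linarith
  have hWW : W (W u) ≠ 0 := by
    intro h0
    have h1 := hskew (W u) u
    rw [h0, inner_zero_left, real_inner_self_eq_norm_sq] at h1
    have h2 := norm_pos_iff.2 hu
    nlinarith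
  -- A nonzero skew map has rank at least two: `W u` and `W (W u)` are orthogonal and nonzero. The
  -- zero set thus lies in an affine space of dimension at most `d - 2`.
  have hli : LinearIndependent ℝ ![(⟨W u, u, rfl⟩ : LinearMap.range W.toLinearMap),
      ⟨W (W u), W u, rfl⟩] := by
    rw [LinearIndependent.pair_iff]
    intro s t hst
    have h1 : s • W u + t • W (W u) = 0 := congrArg Subtype.val hst
    have h2 := congrArg (fun z => inner ℝ z (W u)) h1
    simp only [inner_add_left, real_inner_smul_left, hs (W u), mul_zero, add_zero,
      inner_zero_left, real_inner_self_eq_norm_sq] at h2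
    have hs0 : s = 0 := by
      rcases mul_eq_zero.1 h2 with h3 | h3
      · exact h3
      · exact absurd (norm_eq_zero.1 (pow_eq_zero_iff two_ne_zero |>.1 h3)) hu
    refine ⟨hs0, ?_⟩
    rw [hs0, zero_smul, zero_add] at h1
    exact (smul_eq_zero.1 h1).resolve_right hWW
  have hrank := hli.fintype_card_le_finrank
  have hsum := LinearMap.finrank_range_add_finrank_ker W.toLinearMap
  rw [finrank_euclideanSpace, Fintype.card_fin] at hsum
  rw [Fintype.card_fin] at hrank
  let f : LinearMap.ker W.toLinearMap → E d := fun z => z₀ + z.1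
  have hf : Isometry f := by
    refine Isometry.of_dist_eq fun y z => ?_
    simp only [f, dist_add_left]
    rfl
  have himg : Z ⊆ f '' univ := by
    intro x hx
    refine ⟨⟨x - z₀, ?_⟩, mem_univ _, by simp [f]⟩
    rw [LinearMap.mem_ker]
    change W (x - z₀) = 0
    rw [map_sub, sub_eq_zero]
    exact add_left_cancel ((h x hx).trans (h z₀ hz₀).symm)
  have hdim : dimH Z < ((d - 1 : ℕ) : NNReal) := by
    refine (dimH_mono himg).trans_lt ?_
    rw [hf.dimH_image, Real.dimH_univ_eq_finrank]
    have : Module.finrank ℝ (LinearMap.ker W.toLinearMap) < d - 1 := by omega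
    exact_mod_cast this
  have h0 := hausdorffMeasure_of_dimH_lt hdim
  apply hZ
  rw [surf, Measure.euclideanHausdorffMeasure_def, Measure.smul_apply]
  have h1 : Measure.hausdorffMeasure ((d - 1 : ℕ) : ℝ) Z = 0 := h0
  rw [h1, smul_zero]

end Rigid

/-! ### Finite element functions with vanishing symmetric gradient -/

namespace Mesh.IsShapeRegular

variable {d : ℕ} {M : Mesh d} {Ω Γ : Set (E d)} {k m : ℕ} {κ : ℝ} {v : E d → E d}

/-- A finite element function with vanishing symmetric gradient that vanishes on a boundary part
of positive surface measure is zero. -/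
theorem eqOn_zero_of_symGradSq_eq_zero (hM : M.IsShapeRegular Ω m κ) (hd : 2 ≤ d)
    (hΩ : IsLipschitzDomain Ω) (hsub : Γ ⊆ frontier Ω) (hm : MeasurableSet Γ)
    (hpos : 0 < surf d Γ) (hv : M.IsFEFunction k v) (hD : symGradSq Ω v = 0)
    (h0 : v =ᵐ[(surf d).restrict Γ] 0) : ∀ x ∈ closure Ω, v x = 0 := by
  have hd0 : 0 < d := by omega
  have := M.finite
  have := Fintype.ofFinite M.Cell
  obtain ⟨C, -, hC⟩ := exists_inverse_estimate d k m hd0 κ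
  have hcont := hM.continuousOn_of_isFEFunction hv
  have hcell0 : ∀ c, ∫ x in M.openCell c, frobNorm (symGrad Ω v x) ^ 2 = 0 := by
    have hnn : ∀ c, 0 ≤ ∫ x in M.openCell c, frobNorm (symGrad Ω v x) ^ 2 :=
      fun c => integral_nonneg fun _ => sq_nonneg _
    intro c
    refine le_antisymm ?_ (hnn c)
    refine (Finset.single_le_sum (fun c _ => hnn c) (Finset.mem_univ c)).trans ?_
    exact (hM.sum_openCell_le hd0 hΩ hv).trans_eq hD
  -- The inverse estimate turns vanishing in mean square into vanishing at every point, as the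
  -- classical rigidity argument requires.
  have hsym : ∀ c, ∀ y ∈ M.cell c, symGrad Ω v y = 0 := by
    intro c y hy
    have h1 := hC M Ω v hM hΩ hv c y hy
    rw [hcell0, mul_zero] at h1
    have h2 := pow_pos (hM.diam_pos hd0 c) d
    have h3 : frobNorm (symGrad Ω v y) ^ 2 ≤ 0 := by
      by_contra! h4
      nlinarith [mul_pos h2 h4]
    exact frobNorm_eq_zero (pow_eq_zero_iff two_ne_zero |>.1 (le_antisymm h3 (sq_nonneg _)))
  have hrigid : ∀ c, IsRigidOn v (M.cell c) := by
    intro c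
    refine IsRigidOn.of_subset_closure ?_ (hcont.mono (hM.cell_subset c))
      (M.openCell_subset_cell c) (hM.cell_subset_closure_openCell c)
    refine isRigidOn_of_symPart_fderiv_eq_zero (hM.isOpen_openCell hd0 c)
      (hM.isPreconnected_openCell c) (fun x hx => hM.differentiableAt_of_mem_openCell hd0 hv hx)
      fun x hx => ?_
    rw [← fderivWithin_of_mem_nhds (hM.closure_mem_nhds_of_mem_openCell hd0 hx)]
    exact hsym c x (M.openCell_subset_cell c hx)
  -- In a ball inside `Ω` each segment is covered by cells on which `v` is rigid, so increments are
  -- orthogonal across interfaces too; connectedness and continuity do the rest.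
  have hglob : IsRigidOn v (closure Ω) := by
    refine IsRigidOn.of_subset_closure ?_ hcont subset_closure Subset.rfl
    refine isRigidOn_of_locally hΩ.isConnected.isPreconnected fun x₀ hx₀ => ?_
    obtain ⟨r, hr, hball⟩ := Metric.isOpen_iff.1 hΩ.isOpen x₀ hx₀
    refine ⟨r, hr, isRigidOn_ball hr fun x hx y hy => ?_⟩
    refine inner_sub_eq_zero_of_rigid_pieces (hM.cover.symm ▸ hcont) hrigid ?_
    rw [hM.cover]
    exact ((convex_ball x₀ r).segment_subset hx hy).trans (hball.trans subset_closure)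
  obtain ⟨a, W, hs, hW⟩ := hglob
  have hZ : surf d {x ∈ Γ | v x = 0} ≠ 0 := by
    have h1 : surf d {x ∈ Γ | v x = 0} = surf d Γ := by
      refine measure_congr ?_
      have h2 := (ae_restrict_iff' hm).1 h0
      filter_upwards [h2] with x hx
      exact propext ⟨fun h => h.1, fun h => ⟨h, hx h⟩⟩
    rw [h1]
    exact hpos.ne'
  obtain ⟨ha, hW0⟩ := eq_zero_of_surf_pos hd hs hZ fun x hx => by
    rw [← hW x (frontier_subset_closure (hsub hx.1))]
    exact hx.2
  intro x hx
  simp [hW x hx, ha, hW0]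

end Mesh.IsShapeRegular


/-! ### Coercivity -/

theorem jac_eq_zero_of_eqOn {d : ℕ} {Ω : Set (E d)} {v : E d → E d}
    (h : ∀ x ∈ closure Ω, v x = 0) {x : E d} (hx : x ∈ closure Ω) : jac Ω v x = 0 := by
  have h1 : fderivWithin ℝ v (closure Ω) x = 0 := by
    rw [fderivWithin_congr (f := fun _ => (0 : E d)) h (h x hx)]
    simp
  ext i j
  simp [jac, h1]

theorem symPart_add {d : ℕ} (A B : Matrix (Fin d) (Fin d) ℝ) :
    symPart (A + B) = symPart A + symPart B := by
  ext i j
  simp only [symPart, Submodule.coe_add, Matrix.smul_apply, Matrix.add_apply,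
    Matrix.transpose_apply, smul_eq_mul]
  ring

theorem symPart_smul {d : ℕ} (a : ℝ) (A : Matrix (Fin d) (Fin d) ℝ) :
    symPart (a • A) = a • symPart A := by
  ext i j
  simp only [symPart, Submodule.coe_smul, Matrix.smul_apply, Matrix.add_apply,
    Matrix.transpose_apply, smul_eq_mul]
  ring

namespace Mesh.IsShapeRegular

variable {d : ℕ} {M : Mesh d} {Ω Γ : Set (E d)} {k m : ℕ} {κ : ℝ} {v w : E d → E d}
  (hM : M.IsShapeRegular Ω m κ)

include hM

/-- Additivity may fail on the skeleton, where a missing derivative defaults to zero; almost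
everywhere is enough for a linear map into `L²`. -/
theorem jac_add_ae (hd : 0 < d) (hv : M.IsFEFunction k v) (hw : M.IsFEFunction k w) :
    ∀ᵐ x ∂(volume.restrict Ω), jac Ω (v + w) x = jac Ω v x + jac Ω w x := by
  filter_upwards [hM.mem_iUnion_openCell_ae] with x hx
  obtain ⟨c, hc⟩ := mem_iUnion.1 hx
  have hn := hM.closure_mem_nhds_of_mem_openCell hd hc
  have h1 : fderivWithin ℝ (v + w) (closure Ω) x
      = fderivWithin ℝ v (closure Ω) x + fderivWithin ℝ w (closure Ω) x := by
    rw [fderivWithin_of_mem_nhds hn, fderivWithin_of_mem_nhds hn, fderivWithin_of_mem_nhds hn]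
    exact fderiv_add (hM.differentiableAt_of_mem_openCell hd hv hc)
      (hM.differentiableAt_of_mem_openCell hd hw hc)
  exact (congrArg matOf h1).trans (map_add matOf _ _)

theorem jac_smul_ae (hd : 0 < d) (hv : M.IsFEFunction k v) (a : ℝ) :
    ∀ᵐ x ∂(volume.restrict Ω), jac Ω (a • v) x = a • jac Ω v x := by
  filter_upwards [hM.mem_iUnion_openCell_ae] with x hx
  obtain ⟨c, hc⟩ := mem_iUnion.1 hx
  have hn := hM.closure_mem_nhds_of_mem_openCell hd hc
  have h1 : fderivWithin ℝ (a • v) (closure Ω) x = a • fderivWithin ℝ v (closure Ω) x := by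
    rw [fderivWithin_of_mem_nhds hn, fderivWithin_of_mem_nhds hn]
    exact fderiv_const_smul (hM.differentiableAt_of_mem_openCell hd hv hc) a
  exact (congrArg matOf h1).trans (map_smul matOf _ _)

theorem memLp_of_isFEFunction (hΩ : IsLipschitzDomain Ω) (hv : M.IsFEFunction k v) :
    MemLp v 2 (volume.restrict Ω) := by
  have : IsFiniteMeasure (volume.restrict Ω) :=
    isFiniteMeasure_restrict.2 hΩ.isBounded.measure_lt_top.ne
  obtain ⟨b, hb⟩ := hM.exists_norm_le hΩ hv
  refine MemLp.of_bound (((hM.continuousOn_of_isFEFunction hv).mono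
    subset_closure).aestronglyMeasurable hΩ.isOpen.measurableSet) b ?_
  filter_upwards [ae_restrict_mem hΩ.isOpen.measurableSet] with x hx
  exact hb x (subset_closure hx)

theorem memLp_bdry (hd : 0 < d) (hΩ : IsLipschitzDomain Ω) (hsub : Γ ⊆ frontier Ω)
    (hm : MeasurableSet Γ) (hv : M.IsFEFunction k v) : MemLp v 2 ((surf d).restrict Γ) := by
  have := hM.isFiniteMeasure_bdry hd hΩ hsub
  obtain ⟨b, hb⟩ := hM.exists_norm_le hΩ hv
  refine MemLp.of_bound (hM.aestronglyMeasurable_bdry hsub hv) b ?_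
  filter_upwards [ae_restrict_mem hm] with x hx
  exact hb x (frontier_subset_closure (hsub hx))

/-- A discrete Korn inequality; the constant may depend on the finite element space. -/
theorem exists_korn (hd : 2 ≤ d) (hΩ : IsLipschitzDomain Ω) (hsub : Γ ⊆ frontier Ω)
    (hm : MeasurableSet Γ) (hpos : 0 < surf d Γ) {Vh : Submodule ℝ (E d → E d)}
    (hV : ∀ v ∈ Vh, M.IsFEFunction k v) : ∃ C : ℝ, 0 < C ∧ ∀ v ∈ Vh,
      h1Sq Ω v ≤ C * (symGradSq Ω v + ∫ x in Γ, ‖v x‖ ^ 2 ∂(surf d)) := by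
  have hd0 : 0 < d := by omega
  have := M.finite
  have hFE : ∀ v : Vh, M.IsFEFunction k v.1 := fun v => hV v.1 v.2
  let A₁ : Vh →ₗ[ℝ] Lp (EuclideanSpace ℝ (Fin d × Fin d)) 2 (volume.restrict Ω) :=
    toL2 _ (fun v x => symVec (symGrad Ω v.1 x))
      (fun v => hM.memLp_symVec_symGrad hd0 hΩ (hFE v))
      (fun v w => by
        filter_upwards [hM.jac_add_ae hd0 (hFE v) (hFE w)] with x hx
        rw [Pi.add_apply, ← map_add, symGrad, Submodule.coe_add, hx, symPart_add]
        rfl)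
      (fun a v => by
        filter_upwards [hM.jac_smul_ae hd0 (hFE v) a] with x hx
        rw [Pi.smul_apply, ← map_smul, symGrad, Submodule.coe_smul, hx, symPart_smul]
        rfl)
  let A₂ : Vh →ₗ[ℝ] Lp (E d) 2 ((surf d).restrict Γ) :=
    toL2 _ (fun v => v.1) (fun v => hM.memLp_bdry hd0 hΩ hsub hm (hFE v))
      (fun v w => EventuallyEq.rfl) (fun a v => EventuallyEq.rfl)
  let B₁ : Vh →ₗ[ℝ] Lp (E d) 2 (volume.restrict Ω) :=
    toL2 _ (fun v => v.1) (fun v => hM.memLp_of_isFEFunction hΩ (hFE v))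
      (fun v w => EventuallyEq.rfl) (fun a v => EventuallyEq.rfl)
  let B₂ : Vh →ₗ[ℝ] Lp (EuclideanSpace ℝ (Fin d × Fin d)) 2 (volume.restrict Ω) :=
    toL2 _ (fun v x => matVec (jac Ω v.1 x)) (fun v => hM.memLp_matVec_jac hd0 hΩ (hFE v))
      (fun v w => by
        filter_upwards [hM.jac_add_ae hd0 (hFE v) (hFE w)] with x hx
        rw [Pi.add_apply, ← map_add, Submodule.coe_add, hx])
      (fun a v => by
        filter_upwards [hM.jac_smul_ae hd0 (hFE v) a] with x hx
        rw [Pi.smul_apply, ← map_smul, Submodule.coe_smul, hx])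
  have hA₁ : ∀ v : Vh, ‖A₁ v‖ ^ 2 = symGradSq Ω v.1 := fun v => by
    rw [show ‖A₁ v‖ ^ 2 = _ from norm_toL2_sq v, symGradSq]
    simp only [frobNorm_eq_norm]
  have hA₂ : ∀ v : Vh, ‖A₂ v‖ ^ 2 = ∫ x in Γ, ‖v.1 x‖ ^ 2 ∂(surf d) := fun v => norm_toL2_sq v
  have hB₁ : ∀ v : Vh, ‖B₁ v‖ ^ 2 = ∫ x in Ω, ‖v.1 x‖ ^ 2 := fun v => norm_toL2_sq v
  have hB₂ : ∀ v : Vh, ‖B₂ v‖ ^ 2 = ∫ x in Ω, ∑ i, ∑ j, jac Ω v.1 x i j ^ 2 := fun v => by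
    rw [show ‖B₂ v‖ ^ 2 = _ from norm_toL2_sq v]
    simp only [norm_matVec_sq]
  have hker : LinearMap.ker (A₁.prod A₂) ≤ LinearMap.ker (B₁.prod B₂) := by
    intro v hv
    rw [LinearMap.mem_ker, LinearMap.prod_apply] at hv ⊢
    have h1 : A₁ v = 0 := congrArg Prod.fst hv
    have h2 : A₂ v = 0 := congrArg Prod.snd hv
    have h3 : symGradSq Ω v.1 = 0 := by rw [← hA₁, h1, norm_zero, zero_pow two_ne_zero]
    have h4 : v.1 =ᵐ[(surf d).restrict Γ] 0 := (toL2_eq_zero v).1 h2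
    have h5 := hM.eqOn_zero_of_symGradSq_eq_zero hd hΩ hsub hm hpos (hFE v) h3 h4
    refine Prod.ext ((toL2_eq_zero v).2 ?_) ((toL2_eq_zero v).2 ?_)
    · filter_upwards [ae_restrict_mem hΩ.isOpen.measurableSet] with x hx
      exact h5 x (subset_closure hx)
    · filter_upwards [ae_restrict_mem hΩ.isOpen.measurableSet] with x hx
      rw [jac_eq_zero_of_eqOn h5 (subset_closure hx), map_zero]
      rfl
  -- `Vh` itself may be infinite-dimensional, since values off the closure of `Ω` are unconstrained.
  -- The pullbacks to reference cells lie in the image `Φ` of a finite-dimensional polynomial space,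
  -- and they determine both seminorms.
  let ρ : Vh →ₗ[ℝ] ((c : M.Cell) → M.ref c → E d) :=
    { toFun := fun v c x => v.1 (M.map c x.1)
      map_add' := fun _ _ => rfl
      map_smul' := fun _ _ => rfl }
  let Φ : (M.Cell → Fin d → MvPolynomial.restrictTotalDegree (Fin d) ℝ k) →ₗ[ℝ]
      ((c : M.Cell) → M.ref c → E d) :=
    { toFun := fun P c x => polyMap (fun i => (P c i).1) x.1
      map_add' := fun P Q => by
        funext c x
        ext i
        simp [polyMap]
      map_smul' := fun a P => by
        funext c x
        ext i
        simp [polyMap, MvPolynomial.smul_eval] }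
  have hρΦ : LinearMap.range ρ ≤ LinearMap.range Φ := by
    rintro _ ⟨v, rfl⟩
    choose P hPk hP using (hFE v).exists_poly
    refine ⟨fun c i => ⟨P c i, (MvPolynomial.mem_restrictTotalDegree _ _ _).2 (hPk c i)⟩, ?_⟩
    funext c x
    exact (hP c x.1 x.2).symm
  have hfin : FiniteDimensional ℝ (LinearMap.range ρ) := Submodule.finiteDimensional_of_le hρΦ
  have hkerρ : LinearMap.ker ρ ≤ LinearMap.ker (A₁.prod A₂) := by
    intro v hv
    rw [LinearMap.mem_ker] at hv ⊢
    have h5 : ∀ x ∈ closure Ω, v.1 x = 0 := by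
      intro x hx
      rw [← hM.cover] at hx
      obtain ⟨c, y, hy, rfl⟩ := mem_iUnion.1 hx
      exact congrFun (congrFun hv c) ⟨y, hy⟩
    refine Prod.ext ((toL2_eq_zero v).2 ?_) ((toL2_eq_zero v).2 ?_)
    · filter_upwards [ae_restrict_mem hΩ.isOpen.measurableSet] with x hx
      have h6 : symGrad Ω v.1 x = 0 := by
        rw [symGrad, jac_eq_zero_of_eqOn h5 (subset_closure hx)]
        ext i j
        simp [symPart]
      rw [h6, map_zero]
      rfl
    · filter_upwards [ae_restrict_mem hm] with x hx
      exact h5 x (frontier_subset_closure (hsub hx))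
  have hfinA := finiteDimensional_range_of_ker_le ρ (A₁.prod A₂) hkerρ
  obtain ⟨C, hC, hAB⟩ := exists_norm_le_of_ker_le (A₁.prod A₂) (B₁.prod B₂) hker
  -- The product carries the maximum norm, so each of the two parts of the `H¹` norm is bounded
  -- separately; this gives the factor two.
  refine ⟨2 * C ^ 2, by positivity, fun v hv => ?_⟩
  have h1 := hAB ⟨v, hv⟩
  set z : Vh := ⟨v, hv⟩ with hz
  have h2 : ‖A₁.prod A₂ z‖ ^ 2 ≤ ‖A₁ z‖ ^ 2 + ‖A₂ z‖ ^ 2 := by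
    rw [LinearMap.prod_apply, Prod.norm_def]
    rcases max_cases ‖A₁ z‖ ‖A₂ z‖ with h | h
    · simp only [Function.prod_apply, h.1]
      linarith [sq_nonneg ‖A₂ z‖]
    · simp only [Function.prod_apply, h.1]
      linarith [sq_nonneg ‖A₁ z‖]
  have h3 : ‖B₁ z‖ ^ 2 ≤ ‖B₁.prod B₂ z‖ ^ 2 :=
    pow_le_pow_left₀ (norm_nonneg _) (norm_fst_le (B₁.prod B₂ z)) 2
  have h4 : ‖B₂ z‖ ^ 2 ≤ ‖B₁.prod B₂ z‖ ^ 2 :=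
    pow_le_pow_left₀ (norm_nonneg _) (norm_snd_le (B₁.prod B₂ z)) 2
  have h5 := pow_le_pow_left₀ (norm_nonneg _) h1 2
  rw [mul_pow] at h5
  have h6 : h1Sq Ω v = ‖B₁ z‖ ^ 2 + ‖B₂ z‖ ^ 2 := by rw [hB₁, hB₂, h1Sq]
  rw [h6, show symGradSq Ω v = ‖A₁ z‖ ^ 2 from (hA₁ z).symm,
    show (∫ x in Γ, ‖v x‖ ^ 2 ∂(surf d)) = ‖A₂ z‖ ^ 2 from (hA₂ z).symm]
  have h7 := mul_le_mul_of_nonneg_left h2 (sq_nonneg C)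
  linarith

/-- With finitely many cells the local mesh size is bounded above, so the weighted boundary norm
controls the unweighted one in the Korn inequality. -/
theorem exists_integral_sq_le (hd : 0 < d) (hΩ : IsLipschitzDomain Ω) (hsub : Γ ⊆ frontier Ω)
    (hm : MeasurableSet Γ) {hΓ : E d → ℝ} (hh : M.IsBoundaryMeshSize Γ κ hΓ) :
    ∃ H : ℝ, 0 < H ∧ ∀ v, M.IsFEFunction k v →
      ∫ x in Γ, ‖v x‖ ^ 2 ∂(surf d) ≤ H * bdrySq Γ hΓ v := by
  have := M.finite
  have := Fintype.ofFinite M.Cell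
  have hpos : ∀ c, 0 ≤ κ * M.diam c := fun c =>
    (mul_pos (hM.kappa_pos hd c) (hM.diam_pos hd c)).le
  have hsum : 0 ≤ ∑ c, κ * M.diam c := Finset.sum_nonneg fun c _ => hpos c
  refine ⟨∑ c, κ * M.diam c + 1, by positivity, fun v hv => ?_⟩
  rw [bdrySq, ← integral_const_mul]
  refine integral_mono_of_nonneg (Eventually.of_forall fun x => sq_nonneg _)
    ((hM.integrable_bdrySq hd hΩ hsub hm hh hv).const_mul _) ?_
  filter_upwards [hh.2, ae_restrict_mem hm] with x hx hxΓ
  have hxc : x ∈ ⋃ c, M.cell c := hM.cover ▸ frontier_subset_closure (hsub hxΓ)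
  obtain ⟨c, hc⟩ := mem_iUnion.1 hxc
  have h1 := hx.1
  have h2 : hΓ x ≤ ∑ c, κ * M.diam c + 1 := by
    have := Finset.single_le_sum (fun c _ => hpos c) (Finset.mem_univ c)
    linarith [(hx.2 c hc).1]
  calc ‖v x‖ ^ 2 = hΓ x * ((hΓ x)⁻¹ * ‖v x‖ ^ 2) := by field_simp
    _ ≤ (∑ c, κ * M.diam c + 1) * ((hΓ x)⁻¹ * ‖v x‖ ^ 2) :=
        mul_le_mul_of_nonneg_right h2 (by positivity)

end Mesh.IsShapeRegular

end NitscheNS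

/-! ### Assembly of the theorem -/

theorem mainTheorem1 (d : ℕ) (hd : d = 2 ∨ d = 3) :
    -- the Picard, exact Newton and modified Newton tangents satisfy the tangent bounds
    (∀ R : Rheology, ∃ ηbar : ℝ, R.νInf ≤ ηbar ∧
      ∀ σmax : ℝ, 0 ≤ σmax → ∀ A G : SymMat d,
        R.TangentBounds ηbar (R.picardTangent A) G ∧
        R.TangentBounds ηbar (R.dStress A) G ∧
        R.TangentBounds ηbar (R.modTangent σmax A) G) ∧
    -- coercivity, with a constant depending only on `d`, the degrees, shape regularity, and `η / ν`
    (∀ (k m : ℕ) (κ : ℝ), ∃ C : ℝ → ℝ, (∀ θ, 0 < C θ) ∧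
      ∀ (R : Rheology) (Ω ΓD : Set (E d)) (M : Mesh d) (hΓ : E d → ℝ)
        (Vh : Submodule ℝ (E d → E d))
        (ηbar : ℝ) (T : E d → SymMat d →ₗ[ℝ] SymMat d) (g : E d → E d) (G : E d → SymMat d)
        (γ₁ γ₂ Ctr : ℝ),
        IsLipschitzDomain Ω → ΓD ⊆ frontier Ω → MeasurableSet ΓD →
        M.IsShapeRegular Ω m κ → M.IsBoundaryMeshSize ΓD κ hΓ →
        (∀ v ∈ Vh, M.IsFEFunction k v) →
        R.νInf ≤ ηbar → IsNewtonData R Ω ΓD ηbar T g G →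
        0 < γ₁ → 0 < γ₂ → Ctr = R.νInf * C (ηbar / R.νInf) →
        (∀ v ∈ Vh,
          R.νInf / 2 * symGradSq Ω v + (γ₁ * R.νInf - Ctr) * bdrySq ΓD hΓ v
              + γ₂ * bdryNormalSq Ω ΓD hΓ v
            ≤ nitscheForm R Ω ΓD hΓ T G γ₁ γ₂ v v) ∧
        (2 * Ctr / R.νInf ≤ γ₁ →
          (∀ v ∈ Vh,
            R.νInf / 2 * symGradSq Ω v + γ₁ * R.νInf / 2 * bdrySq ΓD hΓ v
                + γ₂ * bdryNormalSq Ω ΓD hΓ v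
              ≤ nitscheForm R Ω ΓD hΓ T G γ₁ γ₂ v v) ∧
          (0 < surf d ΓD → ∃ α : ℝ, 0 < α ∧ ∀ v ∈ Vh,
            α * h1Sq Ω v ≤ nitscheForm R Ω ΓD hΓ T G γ₁ γ₂ v v))) := by
  have hd2 : 2 ≤ d := by omega
  have hd0 : 0 < d := by omega
  refine ⟨fun R => R.exists_tangentBounds d, fun k m κ => ?_⟩
  obtain ⟨C, hC, hlow⟩ := exists_nitscheForm_lower_bound d k m hd0 κ
  refine ⟨C, hC, ?_⟩
  rintro R Ω ΓD M hΓ Vh ηbar T g G γ₁ γ₂ Ctr hΩ hsub hm hM hh hV - hN hγ₁ hγ₂ rfl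
  have hν := R.νInf_pos
  have ha : ∀ v ∈ Vh, _ := fun v hv =>
    hlow R Ω ΓD M hΓ ηbar T g G γ₁ γ₂ v hΩ hsub hm hM hh (hV v hv) hN hγ₁
  refine ⟨ha, fun hγ => ?_⟩
  have hb : ∀ v ∈ Vh, R.νInf / 2 * symGradSq Ω v + γ₁ * R.νInf / 2 * bdrySq ΓD hΓ v
      + γ₂ * bdryNormalSq Ω ΓD hΓ v ≤ nitscheForm R Ω ΓD hΓ T G γ₁ γ₂ v v := by
    intro v hv
    refine le_trans ?_ (ha v hv)
    have h1 : γ₁ * R.νInf / 2 ≤ γ₁ * R.νInf - R.νInf * C (ηbar / R.νInf) := by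
      rw [div_le_iff₀ hν] at hγ
      linarith
    have h2 := mul_le_mul_of_nonneg_right h1 (bdrySq_nonneg (v := v) hh)
    linarith
  refine ⟨hb, fun hpos => ?_⟩
  obtain ⟨K, hK, hkorn⟩ := hM.exists_korn hd2 hΩ hsub hm hpos hV
  obtain ⟨H, hH, hbdry⟩ := hM.exists_integral_sq_le (k := k) hd0 hΩ hsub hm hh
  -- The largest weight for which `β (‖Dv‖² + H ‖h^(-1/2) v‖²)` stays below the two coercive terms;
  -- the Korn constant `K` then gives `α = β / K`.
  set β := min (R.νInf / 2) (γ₁ * R.νInf / 2 / H) with hβ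
  have hβ0 : 0 < β := lt_min (by positivity) (by positivity)
  refine ⟨β / K, by positivity, fun v hv => ?_⟩
  have h1 := hkorn v hv
  have h2 := hbdry v (hV v hv)
  have h3 := hb v hv
  have h4 : 0 ≤ γ₂ * bdryNormalSq Ω ΓD hΓ v := mul_nonneg hγ₂.le (bdryNormalSq_nonneg hh)
  have h5 : 0 ≤ bdrySq ΓD hΓ v := bdrySq_nonneg hh
  have h6 : 0 ≤ symGradSq Ω v := symGradSq_nonneg
  have h7 : β * symGradSq Ω v ≤ R.νInf / 2 * symGradSq Ω v :=
    mul_le_mul_of_nonneg_right (min_le_left _ _) h6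
  have h8 : β * (H * bdrySq ΓD hΓ v) ≤ γ₁ * R.νInf / 2 * bdrySq ΓD hΓ v := by
    rw [← mul_assoc]
    refine mul_le_mul_of_nonneg_right ?_ h5
    exact (le_div_iff₀ hH).1 (min_le_right _ _)
  calc β / K * h1Sq Ω v
      ≤ β / K * (K * (symGradSq Ω v + ∫ x in ΓD, ‖v x‖ ^ 2 ∂(surf d))) :=
        mul_le_mul_of_nonneg_left h1 (by positivity)
    _ = β * (symGradSq Ω v + ∫ x in ΓD, ‖v x‖ ^ 2 ∂(surf d)) := by field_simp
    _ ≤ β * (symGradSq Ω v + H * bdrySq ΓD hΓ v) :=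
        mul_le_mul_of_nonneg_left (by linarith) hβ0.le
    _ ≤ nitscheForm R Ω ΓD hΓ T G γ₁ γ₂ v v := by rw [mul_add]; linarith
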